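/- Rings are associative but need not have a unit, and ring homomorphisms need not preserve units. Let $R$ be a ring and let $(P,Q,\psi)$ be an $R$-system: $P$ and $Q$ are $R$-bimodules and $\psi:P\otimes_R Q\to R$ is a bimodule homomorphism. For $p\in P$, $q\in Q$ let $\theta_{q,p}(x)=q\,\psi(p\otimes x)$ on $Q$ and $\theta_{p,q}(y)=\psi(y\otimes q)\,p$ on $P$, and let $\mathcal F_P(Q)$, $\mathcal F_Q(P)$ be the additive spans of these operators. Assume condition (FS): for all finite sets $\{q_1,\dots,q_n\}\subseteq Q$ and $\{p_1,\dots,p_m\}\subseteq P$ there are $\Theta\in\mathcal F_P(Q)$ and $\Omega\in\mathcal F_Q(P)$ with $\Theta(q_i)=q_i$ and $\Omega(p_j)=p_j$ for all $i,j$. A covariant representation $(S,T,\sigma,B)$ consists of a ring $B$, a ring homomorphism $\sigma:R\to B$ and additive maps $S:P\to B$, $T:Q\to B$ with $S(pr)=S(p)\sigma(r)$, $S(rp)=\sigma(r)S(p)$, $T(qr)=T(q)\sigma(r)$, $T(rq)=\sigma(r)T(q)$ and $\sigma(\psi(p\otimes q))=S(p)T(q)$. It is surjective if $B$ is generated as a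 ring by $\sigma(R)\cup T(Q)\cup S(P)$, and a surjective one is graded if $B$ has a $\mathbb Z$-grading $B=\bigoplus_n B^{(n)}$ with $\sigma(R)\subseteq B^{(0)}$, $T(Q)\subseteq B^{(1)}$, $S(P)\subseteq B^{(-1)}$. Let $\pi_{T,S}:\mathcal F_P(Q)\to B$ be the homomorphism with $\pi_{T,S}(\theta_{q,p})=T(q)S(p)$, and put $I_{(S,T,\sigma,B)}=\ker\sigma$, $J_{(S,T,\sigma,B)}=\{r\in R:\sigma(r)\in\pi_{T,S}(\mathcal F_P(Q))\}$ and $\omega_{(S,T,\sigma,B)}=(I_{(S,T,\sigma,B)},J_{(S,T,\sigma,B)})$. Let $\Delta(r)(q)=rq$. A two-sided ideal $J$ of $R$ is $\psi$-compatible if $\Delta(J)\subseteq\mathcal F_P(Q)$, and such a $J$ is faithful if $J\cap\ker\Delta=0$. Let $(\iota_P,\iota_Q,\iota_R,\mathcal T_{(P,Q,\psi)})$ be the universal covariant representation (the Toeplitz representation). For a $\psi$-compatible $J$ let $\mathcal O_{(P,Q,\psi)}(J)$ be the quotient of $\mathcal T_{(P,Q,\psi)}$ by the two-sided ideal generated by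 the elements $\iota_R(x)-\pi_{\iota_Q,\iota_P}(\Delta(x))$, $x\in J$. A two-sided ideal $I$ of $R$ is $\psi$-invariant if $\psi(p\otimes xq)\in I$ for all $p\in P$, $q\in Q$, $x\in I$; then $\psi$ induces an $R_I$-system $({}_IP,Q_I,\psi_I)$ with $R_I=R/I$, ${}_IP=P/IP$, $Q_I=Q/QI$, which again satisfies (FS). A $T$-pair is a pair $\omega=(I,J)$ of two-sided ideals of $R$ with $I\subseteq J$ such that $I$ is $\psi$-invariant and $J_I=J/I$ is a faithful $\psi_I$-compatible ideal of $R_I$. Let $\iota^\omega_R,\iota^\omega_Q,\iota^\omega_P$ be the maps from $R,Q,P$ to $\mathcal O_{({}_IP,Q_I,\psi_I)}(J_I)$ obtained by composing the quotient maps onto $R_I,Q_I,{}_IP$ with the canonical maps; they form a covariant representation of $(P,Q,\psi)$. Theorem. Let $(S,T,\sigma,B)$ be a covariant representation of $(P,Q,\psi)$ and let $\omega=(I,J)$ be a $T$-pair. (1) If there is a ring homomorphism $\eta:\mathcal O_{({}_IP,Q_I,\psi_I)}(J_I)\to B$ with $\eta\circ\iota^\omega_R=\sigma$, $\eta\circ\iota^\omega_Q=T$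 and $\eta\circ\iota^\omega_P=S$, then $I\subseteq I_{(S,T,\sigma,B)}$ and $J\subseteq J_{(S,T,\sigma,B)}$. (2) If $I\subseteq I_{(S,T,\sigma,B)}$ and $J\subseteq J_{(S,T,\sigma,B)}$, then there is a unique ring homomorphism $\eta^\omega:\mathcal O_{({}_IP,Q_I,\psi_I)}(J_I)\to B$ with $\eta^\omega\circ\iota^\omega_R=\sigma$, $\eta^\omega\circ\iota^\omega_Q=T$ and $\eta^\omega\circ\iota^\omega_P=S$. (3) In the situation of (2), $\eta^\omega$ is an isomorphism if and only if $(S,T,\sigma,B)$ is surjective and graded and $\omega=\omega_{(S,T,\sigma,B)}$. Consequently, every surjective and graded covariant representation of $(P,Q,\psi)$ is isomorphic to $(\iota^\omega_P,\iota^\omega_Q,\iota^\omega_R,\mathcal O_{({}_IP,Q_I,\psi_I)}(J_I))$ for some $T$-pair $\omega=(I,J)$. -/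

import Mathlib

namespace CuntzPimsner

/-- A bimodule structure on the abelian group `M` over a ring `R` that need not have a unit:
`left r m` is `r m` and `right r m` is `m r`. -/
structure Bimod (R M : Type*) [NonUnitalRing R] [AddCommGroup M] where
  left : R →+ M →+ M
  right : R →+ M →+ M
  left_mul : ∀ r s m, left (r * s) m = left r (left s m)
  right_mul : ∀ r s m, right (r * s) m = right s (right r m)
  left_right : ∀ r s m, left r (right s m) = right s (left r m)

/-- An `R`-system `(P, Q, ψ)`. The bimodule homomorphism `ψ : P ⊗_R Q → R` on the balanced tensor
product is given as the corresponding biadditive, balanced map `ψ p q = ψ(p ⊗ q)`. -/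
structure RSystem (R P Q : Type*) [NonUnitalRing R] [AddCommGroup P] [AddCommGroup Q] where
  modP : Bimod R P
  modQ : Bimod R Q
  ψ : P →+ Q →+ R
  ψ_balanced : ∀ p r q, ψ (modP.right r p) q = ψ p (modQ.left r q)
  ψ_left : ∀ r p q, ψ (modP.left r p) q = r * ψ p q
  ψ_right : ∀ p q r, ψ p (modQ.right r q) = ψ p q * r

namespace RSystem

variable {R P Q : Type*} [NonUnitalRing R] [AddCommGroup P] [AddCommGroup Q]

/-! ### Finite rank operators -/

/-- The rank one operator `θ_{q,p} : Q → Q`, `x ↦ q ψ(p ⊗ x)`. -/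
def theta (X : RSystem R P Q) (q : Q) (p : P) : AddMonoid.End Q where
  toFun x := X.modQ.right (X.ψ p x) q
  map_zero' := by simp
  map_add' x y := by simp

/-- The rank one operator `θ_{p,q} : P → P`, `y ↦ ψ(y ⊗ q) p`. -/
def theta' (X : RSystem R P Q) (p : P) (q : Q) : AddMonoid.End P where
  toFun y := X.modP.left (X.ψ y q) p
  map_zero' := by simp
  map_add' x y := by simp

/-- `F_P(Q)`, the additive span of the operators `θ_{q,p}`. -/
def finRank (X : RSystem R P Q) : AddSubgroup (AddMonoid.End Q) :=
  AddSubgroup.closure {Θ | ∃ q p, Θ = X.theta q p}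

/-- `F_Q(P)`, the additive span of the operators `θ_{p,q}`. -/
def finRank' (X : RSystem R P Q) : AddSubgroup (AddMonoid.End P) :=
  AddSubgroup.closure {Θ | ∃ p q, Θ = X.theta' p q}

/-- Condition (FS). -/
def FS (X : RSystem R P Q) : Prop :=
  ∀ (s : Finset Q) (t : Finset P),
    (∃ Θ ∈ X.finRank, ∀ q ∈ s, Θ q = q) ∧ (∃ Ω ∈ X.finRank', ∀ p ∈ t, Ω p = p)

/-- The left action `Δ : R → End(Q)`, `Δ(r) q = r q`. -/
def Delta (X : RSystem R P Q) (r : R) : AddMonoid.End Q := X.modQ.left r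

/-- A two-sided ideal `J` is `ψ`-compatible if `J ⊆ Δ⁻¹(F_P(Q))`. -/
def Compatible (X : RSystem R P Q) (J : TwoSidedIdeal R) : Prop :=
  ∀ x ∈ J, X.Delta x ∈ X.finRank

/-- A two-sided ideal `J` is faithful if `J ∩ ker Δ = 0`. -/
def Faithful (X : RSystem R P Q) (J : TwoSidedIdeal R) : Prop :=
  ∀ x ∈ J, X.Delta x = 0 → x = 0

/-- The additive map `Q ⊗ P → End(Q)`, `q ⊗ p ↦ θ_{q,p}`. -/
def thetaHom (X : RSystem R P Q) : TensorProduct ℤ Q P →+ AddMonoid.End Q :=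
  TensorProduct.liftAddHom
    (AddMonoidHom.mk' (fun q => AddMonoidHom.mk' (fun p => X.theta q p)
        (fun p p' => AddMonoidHom.ext fun x => by
          change X.modQ.right (X.ψ (p + p') x) q =
            X.modQ.right (X.ψ p x) q + X.modQ.right (X.ψ p' x) q
          simp))
      (fun q q' => AddMonoidHom.ext fun p => AddMonoidHom.ext fun x =>
        map_add (X.modQ.right (X.ψ p x)) q q'))
    (fun n q p => AddMonoidHom.ext fun x => by
      change X.modQ.right (X.ψ p x) (n • q) = X.modQ.right (X.ψ (n • p) x) q
      simp)

@[simp] lemma thetaHom_tmul (X : RSystem R P Q) (q : Q) (p : P) :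
    X.thetaHom (TensorProduct.tmul ℤ q p) = X.theta q p := rfl

lemma mem_finRank_iff (X : RSystem R P Q) (Θ : AddMonoid.End Q) :
    Θ ∈ X.finRank ↔ ∃ t, X.thetaHom t = Θ := by
  constructor
  · intro h
    induction h using AddSubgroup.closure_induction with
    | mem x hx => obtain ⟨q, p, rfl⟩ := hx; exact ⟨_, X.thetaHom_tmul q p⟩
    | zero => exact ⟨0, map_zero _⟩
    | add x y _ _ hx hy =>
      obtain ⟨a, rfl⟩ := hx; obtain ⟨b, rfl⟩ := hy; exact ⟨a + b, map_add _ _ _⟩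
    | neg x _ hx => obtain ⟨a, rfl⟩ := hx; exact ⟨-a, map_neg _ _⟩
  · rintro ⟨t, rfl⟩
    induction t using TensorProduct.induction_on with
    | zero => rw [map_zero]; exact zero_mem _
    | tmul q p => exact AddSubgroup.subset_closure ⟨q, p, rfl⟩
    | add x y hx hy => rw [map_add]; exact add_mem hx hy

lemma exists_fix (t : TensorProduct ℤ Q P) :
    ∃ s : Finset P, ∀ Ω : AddMonoid.End P, (∀ p ∈ s, Ω p = p) →
      TensorProduct.map LinearMap.id Ω.toIntLinearMap t = t := by
  classical
  induction t using TensorProduct.induction_on with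
  | zero => exact ⟨∅, fun _ _ => map_zero _⟩
  | tmul q p =>
    refine ⟨{p}, fun Ω h => ?_⟩
    have h1 : Ω.toIntLinearMap p = p := h p (by simp)
    rw [TensorProduct.map_tmul, h1]; rfl
  | add x y hx hy =>
    obtain ⟨a, ha⟩ := hx
    obtain ⟨b, hb⟩ := hy
    refine ⟨a ∪ b, fun Ω h => ?_⟩
    rw [map_add, ha Ω fun p hp => h p (by simp [hp]), hb Ω fun p hp => h p (by simp [hp])]

end RSystem

/-! ### Covariant representations -/

/-- A covariant representation `(S, T, σ, B)` of the `R`-system `X` on the ring `B`. -/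
structure CovRep {R P Q : Type*} [NonUnitalRing R] [AddCommGroup P] [AddCommGroup Q]
    (X : RSystem R P Q) (B : Type*) [NonUnitalRing B] where
  S : P →+ B
  T : Q →+ B
  σ : R →ₙ+* B
  S_right : ∀ r p, S (X.modP.right r p) = S p * σ r
  S_left : ∀ r p, S (X.modP.left r p) = σ r * S p
  T_right : ∀ r q, T (X.modQ.right r q) = T q * σ r
  T_left : ∀ r q, T (X.modQ.left r q) = σ r * T q
  σ_ψ : ∀ p q, σ (X.ψ p q) = S p * T q

namespace CovRep

variable {R P Q : Type*} [NonUnitalRing R] [AddCommGroup P] [AddCommGroup Q]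
  {X : RSystem R P Q} {B : Type*} [NonUnitalRing B]

/-- `(S, T, σ, B)` is surjective if `B` is generated by `σ(R) ∪ T(Q) ∪ S(P)`. -/
def Surjective (ρ : CovRep X B) : Prop :=
  NonUnitalSubring.closure (Set.range ρ.σ ∪ Set.range ρ.T ∪ Set.range ρ.S) = ⊤

/-- `(S, T, σ, B)` is graded if there is a `ℤ`-grading `B = ⨁ B⁽ⁿ⁾` with `σ(R) ⊆ B⁽⁰⁾`,
`T(Q) ⊆ B⁽¹⁾` and `S(P) ⊆ B⁽⁻¹⁾`. -/
def Graded (ρ : CovRep X B) : Prop :=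
  ∃ 𝓑 : ℤ → AddSubgroup B, DirectSum.IsInternal 𝓑 ∧
    (∀ m n, ∀ x ∈ 𝓑 m, ∀ y ∈ 𝓑 n, x * y ∈ 𝓑 (m + n)) ∧
    (∀ r, ρ.σ r ∈ 𝓑 0) ∧ (∀ q, ρ.T q ∈ 𝓑 1) ∧ (∀ p, ρ.S p ∈ 𝓑 (-1))

/-- The additive map `Q ⊗ P → B`, `q ⊗ p ↦ T(q) S(p)`. -/
def TS (ρ : CovRep X B) : TensorProduct ℤ Q P →+ B :=
  TensorProduct.liftAddHom
    (AddMonoidHom.mk' (fun q => AddMonoidHom.mk' (fun p => ρ.T q * ρ.S p)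
        (fun p p' => by simp [mul_add]))
      (fun q q' => by ext p; simp [add_mul]))
    (by intro n q p; simp [smul_mul_assoc, mul_smul_comm])

@[simp] lemma TS_tmul (ρ : CovRep X B) (q : Q) (p : P) :
    ρ.TS (TensorProduct.tmul ℤ q p) = ρ.T q * ρ.S p := rfl

lemma TS_map (ρ : CovRep X B) (p : P) (q : Q) (t : TensorProduct ℤ Q P) :
    ρ.TS (TensorProduct.map LinearMap.id (X.theta' p q).toIntLinearMap t) =
      ρ.T (X.thetaHom t q) * ρ.S p := by
  induction t using TensorProduct.induction_on with
  | zero => simp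
  | tmul a b =>
    have h : (X.theta' p q).toIntLinearMap b = X.modP.left (X.ψ b q) p := rfl
    have h' : X.theta a b q = X.modQ.right (X.ψ b q) a := rfl
    rw [TensorProduct.map_tmul, h, RSystem.thetaHom_tmul, h', LinearMap.id_apply, TS_tmul,
      ρ.S_left, ρ.T_right, mul_assoc]
  | add x y hx hy =>
    have h : (X.thetaHom (x + y)) q = X.thetaHom x q + X.thetaHom y q := by rw [map_add]; rfl
    rw [map_add, map_add, hx, hy, h, map_add, add_mul]

lemma TS_eq_zero (ρ : CovRep X B) (hX : X.FS) (t : TensorProduct ℤ Q P)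
    (ht : X.thetaHom t = 0) : ρ.TS t = 0 := by
  obtain ⟨s, hs⟩ := RSystem.exists_fix t
  obtain ⟨Ω, hΩ, hfix⟩ := (hX ∅ s).2
  rw [← hs Ω hfix]
  clear hfix
  induction hΩ using AddSubgroup.closure_induction with
  | mem x hx =>
    obtain ⟨p, q, rfl⟩ := hx
    rw [TS_map, ht]; simp
  | zero =>
    have : (AddMonoidHom.toIntLinearMap (0 : AddMonoid.End P)) = 0 := rfl
    rw [this, TensorProduct.map_zero_right]; simp
  | add x y _ _ hx hy =>
    have : AddMonoidHom.toIntLinearMap (x + y) = x.toIntLinearMap + y.toIntLinearMap := rfl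
    rw [this, TensorProduct.map_add_right, LinearMap.add_apply, map_add, hx, hy, add_zero]
  | neg x _ hx =>
    have : AddMonoidHom.toIntLinearMap (-x) = (-1 : ℤ) • x.toIntLinearMap := by
      ext p
      rw [LinearMap.smul_apply, neg_one_zsmul]; rfl
    rw [this, TensorProduct.map_smul_right, LinearMap.smul_apply, map_zsmul, hx, smul_zero]

/-- The homomorphism `π_{T,S} : F_P(Q) → B`, determined by `π_{T,S}(θ_{q,p}) = T(q) S(p)`. It is
well defined because of condition (FS). -/
noncomputable def pi (ρ : CovRep X B) (hX : X.FS) : X.finRank →+ B :=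
  AddMonoidHom.mk' (fun Θ => ρ.TS ((X.mem_finRank_iff Θ.1).1 Θ.2).choose) (by
    intro Θ Θ'
    rw [← sub_eq_zero, ← map_add, ← map_sub]
    refine ρ.TS_eq_zero hX _ ?_
    rw [map_sub, map_add, ((X.mem_finRank_iff _).1 (Θ + Θ').2).choose_spec,
      ((X.mem_finRank_iff _).1 Θ.2).choose_spec, ((X.mem_finRank_iff _).1 Θ'.2).choose_spec,
      AddSubgroup.coe_add, sub_self])

lemma pi_thetaHom (ρ : CovRep X B) (hX : X.FS) (t : TensorProduct ℤ Q P)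
    (h : X.thetaHom t ∈ X.finRank) : ρ.pi hX ⟨X.thetaHom t, h⟩ = ρ.TS t := by
  rw [← sub_eq_zero]
  change ρ.TS ((X.mem_finRank_iff (X.thetaHom t)).1 h).choose - ρ.TS t = 0
  rw [← map_sub]
  refine ρ.TS_eq_zero hX _ ?_
  rw [map_sub, ((X.mem_finRank_iff _).1 h).choose_spec, sub_self]

lemma pi_theta (ρ : CovRep X B) (hX : X.FS) (q : Q) (p : P) :
    ρ.pi hX ⟨X.theta q p, AddSubgroup.subset_closure ⟨q, p, rfl⟩⟩ = ρ.T q * ρ.S p :=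
  ρ.pi_thetaHom hX (TensorProduct.tmul ℤ q p) _

lemma exists_pi_iff (ρ : CovRep X B) (hX : X.FS) (b : B) :
    (∃ Θ, b = ρ.pi hX Θ) ↔ ∃ t, b = ρ.TS t := by
  constructor
  · rintro ⟨Θ, rfl⟩; exact ⟨_, rfl⟩
  · rintro ⟨t, rfl⟩
    exact ⟨⟨X.thetaHom t, (X.mem_finRank_iff _).2 ⟨t, rfl⟩⟩, (ρ.pi_thetaHom hX t _).symm⟩

lemma mul_TS (ρ : CovRep X B) (r : R) (t : TensorProduct ℤ Q P) :
    ∃ t', ρ.σ r * ρ.TS t = ρ.TS t' := by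
  induction t using TensorProduct.induction_on with
  | zero => exact ⟨0, by simp⟩
  | tmul q p => exact ⟨TensorProduct.tmul ℤ (X.modQ.left r q) p, by simp [ρ.T_left, mul_assoc]⟩
  | add x y hx hy =>
    obtain ⟨a, ha⟩ := hx; obtain ⟨b, hb⟩ := hy
    exact ⟨a + b, by rw [map_add, mul_add, ha, hb, map_add]⟩

lemma TS_mul (ρ : CovRep X B) (r : R) (t : TensorProduct ℤ Q P) :
    ∃ t', ρ.TS t * ρ.σ r = ρ.TS t' := by
  induction t using TensorProduct.induction_on with
  | zero => exact ⟨0, by simp⟩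
  | tmul q p => exact ⟨TensorProduct.tmul ℤ q (X.modP.right r p), by simp [ρ.S_right, mul_assoc]⟩
  | add x y hx hy =>
    obtain ⟨a, ha⟩ := hx; obtain ⟨b, hb⟩ := hy
    exact ⟨a + b, by rw [map_add, add_mul, ha, hb, map_add]⟩

/-- The two-sided ideal `I_{(S,T,σ,B)} = ker σ`. -/
def idealI (ρ : CovRep X B) : TwoSidedIdeal R := TwoSidedIdeal.ker ρ.σ

/-- The two-sided ideal `J_{(S,T,σ,B)} = {r ∈ R | σ(r) ∈ π_{T,S}(F_P(Q))}`. -/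
noncomputable def idealJ (ρ : CovRep X B) (hX : X.FS) : TwoSidedIdeal R :=
  TwoSidedIdeal.mk' {r | ∃ Θ : X.finRank, ρ.σ r = ρ.pi hX Θ}
    ⟨0, by simp⟩
    (by rintro x y ⟨a, ha⟩ ⟨b, hb⟩; exact ⟨a + b, by rw [map_add, map_add, ha, hb]⟩)
    (by rintro x ⟨a, ha⟩; exact ⟨-a, by rw [map_neg, map_neg, ha]⟩)
    (by
      intro x y hy
      obtain ⟨t, ht⟩ := (ρ.exists_pi_iff hX _).1 hy
      obtain ⟨t', ht'⟩ := ρ.mul_TS x t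
      exact (ρ.exists_pi_iff hX _).2 ⟨t', by rw [map_mul, ht, ht']⟩)
    (by
      intro x y hx
      obtain ⟨t, ht⟩ := (ρ.exists_pi_iff hX _).1 hx
      obtain ⟨t', ht'⟩ := ρ.TS_mul y t
      exact (ρ.exists_pi_iff hX _).2 ⟨t', by rw [map_mul, ht, ht']⟩)

/-- The pair `ω_{(S,T,σ,B)} = (I_{(S,T,σ,B)}, J_{(S,T,σ,B)})`. -/
noncomputable def pair (ρ : CovRep X B) (hX : X.FS) : TwoSidedIdeal R × TwoSidedIdeal R :=
  (ρ.idealI, ρ.idealJ hX)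

/-- Composition of a covariant representation with a ring homomorphism. -/
def comp {C : Type*} [NonUnitalRing C] (ρ : CovRep X B) (f : B →ₙ+* C) : CovRep X C where
  S := (f : B →+ C).comp ρ.S
  T := (f : B →+ C).comp ρ.T
  σ := f.comp ρ.σ
  S_right r p := by simp [ρ.S_right]
  S_left r p := by simp [ρ.S_left]
  T_right r q := by simp [ρ.T_right]
  T_left r q := by simp [ρ.T_left]
  σ_ψ p q := by simp [ρ.σ_ψ]

end CovRep

/-! ### The Toeplitz ring -/

/-- Generators of the Toeplitz ring. -/
inductive Gen (R P Q : Type*)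
  | r (x : R) : Gen R P Q
  | p (x : P) : Gen R P Q
  | q (x : Q) : Gen R P Q

/-- The free ring (without unit) on the set of generators. -/
abbrev FreeRng (R P Q : Type*) := MonoidAlgebra ℤ (FreeSemigroup (Gen R P Q))

/-- A generator, as an element of the free ring. -/
noncomputable def FreeRng.gen {R P Q : Type*} (a : Gen R P Q) : FreeRng R P Q :=
  MonoidAlgebra.single (FreeSemigroup.of a) 1

/-- The canonical map from a ring onto its quotient by a congruence, as a ring homomorphism. -/
def quotHom {A : Type*} [NonUnitalRing A] (c : RingCon A) : A →ₙ+* c.Quotient where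
  toFun := c.toQuotient
  map_zero' := rfl
  map_add' _ _ := rfl
  map_mul' _ _ := rfl

lemma quotHom_surjective {A : Type*} [NonUnitalRing A] (c : RingCon A) :
    Function.Surjective (quotHom c) := fun x => Quotient.inductionOn' x fun a => ⟨a, rfl⟩

namespace RSystem

variable {R P Q : Type*} [NonUnitalRing R] [AddCommGroup P] [AddCommGroup Q]

open FreeRng in
/-- The relations of the Toeplitz ring: they say exactly that the generators form a covariant
representation. -/
inductive Rel (X : RSystem R P Q) : FreeRng R P Q → FreeRng R P Q → Prop
  | add_r (a b : R) : Rel X (gen (.r (a + b))) (gen (.r a) + gen (.r b))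
  | mul_r (a b : R) : Rel X (gen (.r (a * b))) (gen (.r a) * gen (.r b))
  | add_p (a b : P) : Rel X (gen (.p (a + b))) (gen (.p a) + gen (.p b))
  | add_q (a b : Q) : Rel X (gen (.q (a + b))) (gen (.q a) + gen (.q b))
  | right_p (r : R) (p : P) : Rel X (gen (.p (X.modP.right r p))) (gen (.p p) * gen (.r r))
  | left_p (r : R) (p : P) : Rel X (gen (.p (X.modP.left r p))) (gen (.r r) * gen (.p p))
  | right_q (r : R) (q : Q) : Rel X (gen (.q (X.modQ.right r q))) (gen (.q q) * gen (.r r))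
  | left_q (r : R) (q : Q) : Rel X (gen (.q (X.modQ.left r q))) (gen (.r r) * gen (.q q))
  | psi (p : P) (q : Q) : Rel X (gen (.r (X.ψ p q))) (gen (.p p) * gen (.q q))

/-- The Toeplitz ring `T_{(P,Q,ψ)}`: the universal ring carrying a covariant representation. -/
abbrev Toeplitz (X : RSystem R P Q) : Type _ := (ringConGen X.Rel).Quotient

lemma toeplitz_rel (X : RSystem R P Q) {a b : FreeRng R P Q} (h : X.Rel a b) :
    quotHom (ringConGen X.Rel) a = quotHom (ringConGen X.Rel) b :=
  (RingCon.eq _).2 (RingConGen.Rel.of _ _ h)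

/-- The Toeplitz representation `(ι_P, ι_Q, ι_R, T_{(P,Q,ψ)})`. -/
noncomputable def toeplitzRep (X : RSystem R P Q) : CovRep X X.Toeplitz where
  S := AddMonoidHom.mk' (fun p => quotHom _ (FreeRng.gen (.p p)))
    (fun a b => by rw [← map_add]; exact X.toeplitz_rel (.add_p a b))
  T := AddMonoidHom.mk' (fun q => quotHom _ (FreeRng.gen (.q q)))
    (fun a b => by rw [← map_add]; exact X.toeplitz_rel (.add_q a b))
  σ :=
    { AddMonoidHom.mk' (fun r => quotHom (ringConGen X.Rel) (FreeRng.gen (.r r)))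
        (fun a b => by rw [← map_add]; exact X.toeplitz_rel (.add_r a b)) with
      map_mul' := fun a b => (X.toeplitz_rel (.mul_r a b)).trans (map_mul _ _ _) }
  S_right r p := (X.toeplitz_rel (.right_p r p)).trans (map_mul _ _ _)
  S_left r p := (X.toeplitz_rel (.left_p r p)).trans (map_mul _ _ _)
  T_right r q := (X.toeplitz_rel (.right_q r q)).trans (map_mul _ _ _)
  T_left r q := (X.toeplitz_rel (.left_q r q)).trans (map_mul _ _ _)
  σ_ψ p q := (X.toeplitz_rel (.psi p q)).trans (map_mul _ _ _)

/-! ### Relative Cuntz-Pimsner rings -/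

/-- `T(J)`, the two-sided ideal of the Toeplitz ring generated by the elements
`ι_R(x) - π(Δ(x))` for `x ∈ J`. -/
noncomputable def toeplitzIdeal (X : RSystem R P Q) (hX : X.FS) (J : TwoSidedIdeal R)
    (hJ : X.Compatible J) : TwoSidedIdeal X.Toeplitz :=
  TwoSidedIdeal.span {t | ∃ (x : R) (hx : x ∈ J),
    t = X.toeplitzRep.σ x - X.toeplitzRep.pi hX ⟨X.Delta x, hJ x hx⟩}

/-- The Cuntz-Pimsner ring `O_{(P,Q,ψ)}(J) = T_{(P,Q,ψ)} / T(J)` relative to `J`. -/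
abbrev CPRing (X : RSystem R P Q) (hX : X.FS) (J : TwoSidedIdeal R) (hJ : X.Compatible J) :
    Type _ :=
  (X.toeplitzIdeal hX J hJ).ringCon.Quotient

/-- The Cuntz-Pimsner representation `(ι_P^J, ι_Q^J, ι_R^J, O_{(P,Q,ψ)}(J))` relative to `J`. -/
noncomputable def cpRep (X : RSystem R P Q) (hX : X.FS) (J : TwoSidedIdeal R)
    (hJ : X.Compatible J) : CovRep X (X.CPRing hX J hJ) :=
  X.toeplitzRep.comp (quotHom _)

/-! ### Quotient systems -/

/-- A two-sided ideal `I` of `R` is `ψ`-invariant if `ψ(p ⊗ x q) ∈ I` for all `x ∈ I`. -/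
def Invariant (X : RSystem R P Q) (I : TwoSidedIdeal R) : Prop :=
  ∀ (p : P) (q : Q), ∀ x ∈ I, X.ψ p (X.modQ.left x q) ∈ I

/-- `QI = span {q x | q ∈ Q, x ∈ I}`. -/
def QI (X : RSystem R P Q) (I : TwoSidedIdeal R) : AddSubgroup Q :=
  AddSubgroup.closure {y | ∃ (q : Q) (x : R), x ∈ I ∧ y = X.modQ.right x q}

/-- `IP = span {x p | p ∈ P, x ∈ I}`. -/
def IP (X : RSystem R P Q) (I : TwoSidedIdeal R) : AddSubgroup P :=
  AddSubgroup.closure {y | ∃ (p : P) (x : R), x ∈ I ∧ y = X.modP.left x p}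

/-- `R_I = R / I`. -/
abbrev RQuot (_X : RSystem R P Q) (I : TwoSidedIdeal R) : Type _ := I.ringCon.Quotient

/-- `Q_I = Q / QI`. -/
abbrev QQuot (X : RSystem R P Q) (I : TwoSidedIdeal R) : Type _ := Q ⧸ X.QI I

/-- `_I P = P / IP`. -/
abbrev PQuot (X : RSystem R P Q) (I : TwoSidedIdeal R) : Type _ := P ⧸ X.IP I

lemma map_QI_le (X : RSystem R P Q) (I : TwoSidedIdeal R) (f : Q →+ Q)
    (h : ∀ q, ∀ x ∈ I, f (X.modQ.right x q) ∈ X.QI I) : X.QI I ≤ (X.QI I).comap f := by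
  refine (AddSubgroup.closure_le _).2 ?_
  rintro _ ⟨q, x, hx, rfl⟩
  exact h q x hx

lemma map_IP_le (X : RSystem R P Q) (I : TwoSidedIdeal R) (f : P →+ P)
    (h : ∀ p, ∀ x ∈ I, f (X.modP.left x p) ∈ X.IP I) : X.IP I ≤ (X.IP I).comap f := by
  refine (AddSubgroup.closure_le _).2 ?_
  rintro _ ⟨q, x, hx, rfl⟩
  exact h q x hx

lemma right_mem_QI (X : RSystem R P Q) {I : TwoSidedIdeal R} {x : R} (hx : x ∈ I) (q : Q) :
    X.modQ.right x q ∈ X.QI I := AddSubgroup.subset_closure ⟨q, x, hx, rfl⟩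

lemma left_mem_IP (X : RSystem R P Q) {I : TwoSidedIdeal R} {x : R} (hx : x ∈ I) (p : P) :
    X.modP.left x p ∈ X.IP I := AddSubgroup.subset_closure ⟨p, x, hx, rfl⟩

lemma QI_left (X : RSystem R P Q) (I : TwoSidedIdeal R) (r : R) :
    X.QI I ≤ (X.QI I).comap (X.modQ.left r) :=
  X.map_QI_le I _ fun q x hx => by rw [X.modQ.left_right]; exact X.right_mem_QI hx _

lemma QI_right (X : RSystem R P Q) (I : TwoSidedIdeal R) (r : R) :
    X.QI I ≤ (X.QI I).comap (X.modQ.right r) :=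
  X.map_QI_le I _ fun q x hx => by
    rw [← X.modQ.right_mul]; exact X.right_mem_QI (I.mul_mem_right _ _ hx) _

lemma IP_left (X : RSystem R P Q) (I : TwoSidedIdeal R) (r : R) :
    X.IP I ≤ (X.IP I).comap (X.modP.left r) :=
  X.map_IP_le I _ fun p x hx => by
    rw [← X.modP.left_mul]; exact X.left_mem_IP (I.mul_mem_left _ _ hx) _

lemma IP_right (X : RSystem R P Q) (I : TwoSidedIdeal R) (r : R) :
    X.IP I ≤ (X.IP I).comap (X.modP.right r) :=
  X.map_IP_le I _ fun p x hx => by rw [← X.modP.left_right]; exact X.left_mem_IP hx _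

lemma finRank_mem_QI (X : RSystem R P Q) (I : TwoSidedIdeal R) {Θ : AddMonoid.End Q}
    (hΘ : Θ ∈ X.finRank) (y : Q) (hy : ∀ p, X.ψ p y ∈ I) : Θ y ∈ X.QI I := by
  induction hΘ using AddSubgroup.closure_induction with
  | mem x hx => obtain ⟨q, p, rfl⟩ := hx; exact X.right_mem_QI (hy p) q
  | zero => exact zero_mem _
  | add a b _ _ ha hb => exact add_mem ha hb
  | neg a _ ha => exact neg_mem ha

lemma finRank_mem_IP (X : RSystem R P Q) (I : TwoSidedIdeal R) {Θ : AddMonoid.End P}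
    (hΘ : Θ ∈ X.finRank') (y : P) (hy : ∀ q, X.ψ y q ∈ I) : Θ y ∈ X.IP I := by
  induction hΘ using AddSubgroup.closure_induction with
  | mem x hx => obtain ⟨p, q, rfl⟩ := hx; exact X.left_mem_IP (hy q) p
  | zero => exact zero_mem _
  | add a b _ _ ha hb => exact add_mem ha hb
  | neg a _ ha => exact neg_mem ha

/-- `IQ ⊆ QI` for a `ψ`-invariant ideal `I`. -/
lemma left_mem_QI (X : RSystem R P Q) (hX : X.FS) {I : TwoSidedIdeal R} (hI : X.Invariant I)
    {x : R} (hx : x ∈ I) (q : Q) : X.modQ.left x q ∈ X.QI I := by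
  obtain ⟨Θ, hΘ, h⟩ := (hX {X.modQ.left x q} ∅).1
  rw [← h _ (Finset.mem_singleton_self _)]
  exact X.finRank_mem_QI I hΘ _ fun p => hI p q x hx

/-- `PI ⊆ IP` for a `ψ`-invariant ideal `I`. -/
lemma right_mem_IP (X : RSystem R P Q) (hX : X.FS) {I : TwoSidedIdeal R} (hI : X.Invariant I)
    {x : R} (hx : x ∈ I) (p : P) : X.modP.right x p ∈ X.IP I := by
  obtain ⟨Θ, hΘ, h⟩ := (hX ∅ {X.modP.right x p}).2
  rw [← h _ (Finset.mem_singleton_self _)]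
  exact X.finRank_mem_IP I hΘ _ fun q => by rw [X.ψ_balanced]; exact hI p q x hx

/-- Extension of an additive map that vanishes on `I` to `R / I`. -/
def liftIdeal {A : Type*} [AddCommGroup A] (I : TwoSidedIdeal R) (f : R →+ A)
    (h : ∀ x ∈ I, f x = 0) : I.ringCon.Quotient →+ A where
  toFun := Quotient.lift (s := I.ringCon.toSetoid) f fun a b hab => by
    rw [← sub_eq_zero, ← map_sub]; exact h _ ((I.rel_iff a b).1 hab)
  map_zero' := map_zero f
  map_add' x y := Quotient.inductionOn₂' x y fun a b => map_add f a b

/-- The `R_I`-bimodule `Q_I`. -/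
def quotQ (X : RSystem R P Q) (hX : X.FS) (I : TwoSidedIdeal R) (hI : X.Invariant I) :
    Bimod (X.RQuot I) (X.QQuot I) where
  left := liftIdeal I
    (AddMonoidHom.mk' (fun r => QuotientAddGroup.map _ _ (X.modQ.left r) (X.QI_left I r))
      (fun r s => by ext q; simp))
    (fun x hx => by
      ext q
      exact (QuotientAddGroup.eq_zero_iff _).2 (X.left_mem_QI hX hI hx q))
  right := liftIdeal I
    (AddMonoidHom.mk' (fun r => QuotientAddGroup.map _ _ (X.modQ.right r) (X.QI_right I r))
      (fun r s => by ext q; simp))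
    (fun x hx => by
      ext q
      exact (QuotientAddGroup.eq_zero_iff _).2 (X.right_mem_QI hx q))
  left_mul r s m := Quotient.inductionOn₂' r s fun r s => Quotient.inductionOn' m fun m =>
    congrArg (QuotientAddGroup.mk (s := X.QI I)) (X.modQ.left_mul r s m)
  right_mul r s m := Quotient.inductionOn₂' r s fun r s => Quotient.inductionOn' m fun m =>
    congrArg (QuotientAddGroup.mk (s := X.QI I)) (X.modQ.right_mul r s m)
  left_right r s m := Quotient.inductionOn₂' r s fun r s => Quotient.inductionOn' m fun m =>
    congrArg (QuotientAddGroup.mk (s := X.QI I)) (X.modQ.left_right r s m)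

/-- The `R_I`-bimodule `_I P`. -/
def quotP (X : RSystem R P Q) (hX : X.FS) (I : TwoSidedIdeal R) (hI : X.Invariant I) :
    Bimod (X.RQuot I) (X.PQuot I) where
  left := liftIdeal I
    (AddMonoidHom.mk' (fun r => QuotientAddGroup.map _ _ (X.modP.left r) (X.IP_left I r))
      (fun r s => by ext q; simp))
    (fun x hx => by
      ext q
      exact (QuotientAddGroup.eq_zero_iff _).2 (X.left_mem_IP hx q))
  right := liftIdeal I
    (AddMonoidHom.mk' (fun r => QuotientAddGroup.map _ _ (X.modP.right r) (X.IP_right I r))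
      (fun r s => by ext q; simp))
    (fun x hx => by
      ext q
      exact (QuotientAddGroup.eq_zero_iff _).2 (X.right_mem_IP hX hI hx q))
  left_mul r s m := Quotient.inductionOn₂' r s fun r s => Quotient.inductionOn' m fun m =>
    congrArg (QuotientAddGroup.mk (s := X.IP I)) (X.modP.left_mul r s m)
  right_mul r s m := Quotient.inductionOn₂' r s fun r s => Quotient.inductionOn' m fun m =>
    congrArg (QuotientAddGroup.mk (s := X.IP I)) (X.modP.right_mul r s m)
  left_right r s m := Quotient.inductionOn₂' r s fun r s => Quotient.inductionOn' m fun m =>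
    congrArg (QuotientAddGroup.mk (s := X.IP I)) (X.modP.left_right r s m)

lemma quotHom_eq_zero (I : TwoSidedIdeal R) {x : R} (hx : x ∈ I) : quotHom I.ringCon x = 0 :=
  (RingCon.eq _).2 ((I.mem_iff x).1 hx)

/-- `ψ_I(℘_I(p) ⊗ ℘_I(q)) = ℘_I(ψ(p ⊗ q))`. -/
def quotψ (X : RSystem R P Q) (I : TwoSidedIdeal R) : X.PQuot I →+ X.QQuot I →+ X.RQuot I :=
  QuotientAddGroup.lift _
    (AddMonoidHom.mk'
      (fun p => QuotientAddGroup.lift (X.QI I)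
        ((quotHom I.ringCon : R →+ I.ringCon.Quotient).comp (X.ψ p))
        ((AddSubgroup.closure_le (AddMonoidHom.ker _)).2 (by
          rintro _ ⟨q, x, hx, rfl⟩
          refine quotHom_eq_zero I ?_
          rw [X.ψ_right]
          exact I.mul_mem_left _ _ hx)))
      (fun p p' => by
        ext q
        change quotHom I.ringCon (X.ψ (p + p') q) =
          quotHom I.ringCon (X.ψ p q) + quotHom I.ringCon (X.ψ p' q)
        simp))
    ((AddSubgroup.closure_le (AddMonoidHom.ker _)).2 (by
      rintro _ ⟨p, x, hx, rfl⟩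
      refine AddMonoidHom.mem_ker.2 ?_
      ext q
      refine quotHom_eq_zero I ?_
      rw [X.ψ_left]
      exact I.mul_mem_right _ _ hx))

/-- The `R_I`-system `(_I P, Q_I, ψ_I)`. -/
def quot (X : RSystem R P Q) (hX : X.FS) (I : TwoSidedIdeal R) (hI : X.Invariant I) :
    RSystem (X.RQuot I) (X.PQuot I) (X.QQuot I) where
  modP := X.quotP hX I hI
  modQ := X.quotQ hX I hI
  ψ := X.quotψ I
  ψ_balanced p r q := Quotient.inductionOn₂' p q fun p q => Quotient.inductionOn' r fun r =>
    congrArg (quotHom I.ringCon) (X.ψ_balanced p r q)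
  ψ_left r p q := Quotient.inductionOn₂' p q fun p q => Quotient.inductionOn' r fun r =>
    congrArg (quotHom I.ringCon) (X.ψ_left r p q)
  ψ_right p q r := Quotient.inductionOn₂' p q fun p q => Quotient.inductionOn' r fun r =>
    congrArg (quotHom I.ringCon) (X.ψ_right p q r)

lemma quot_finRank (X : RSystem R P Q) (hX : X.FS) (I : TwoSidedIdeal R) (hI : X.Invariant I)
    {Θ : AddMonoid.End Q} (hΘ : Θ ∈ X.finRank) :
    ∃ Θ' ∈ (X.quot hX I hI).finRank, ∀ q : Q, Θ' (q : X.QQuot I) = (Θ q : X.QQuot I) := by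
  induction hΘ using AddSubgroup.closure_induction with
  | mem x hx =>
    obtain ⟨q, p, rfl⟩ := hx
    exact ⟨_, AddSubgroup.subset_closure ⟨(q : X.QQuot I), (p : X.PQuot I), rfl⟩, fun _ => rfl⟩
  | zero => exact ⟨0, zero_mem _, fun _ => rfl⟩
  | add a b _ _ ha hb =>
    obtain ⟨a', ha', h⟩ := ha
    obtain ⟨b', hb', h'⟩ := hb
    refine ⟨a' + b', add_mem ha' hb', fun q => ?_⟩
    exact congrArg₂ (· + ·) (h q) (h' q)
  | neg a _ ha =>
    obtain ⟨a', ha', h⟩ := ha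
    refine ⟨-a', neg_mem ha', fun q => ?_⟩
    exact congrArg (- ·) (h q)

lemma quot_finRank' (X : RSystem R P Q) (hX : X.FS) (I : TwoSidedIdeal R) (hI : X.Invariant I)
    {Θ : AddMonoid.End P} (hΘ : Θ ∈ X.finRank') :
    ∃ Θ' ∈ (X.quot hX I hI).finRank', ∀ p : P, Θ' (p : X.PQuot I) = (Θ p : X.PQuot I) := by
  induction hΘ using AddSubgroup.closure_induction with
  | mem x hx =>
    obtain ⟨p, q, rfl⟩ := hx
    exact ⟨_, AddSubgroup.subset_closure ⟨(p : X.PQuot I), (q : X.QQuot I), rfl⟩, fun _ => rfl⟩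
  | zero => exact ⟨0, zero_mem _, fun _ => rfl⟩
  | add a b _ _ ha hb =>
    obtain ⟨a', ha', h⟩ := ha
    obtain ⟨b', hb', h'⟩ := hb
    refine ⟨a' + b', add_mem ha' hb', fun q => ?_⟩
    exact congrArg₂ (· + ·) (h q) (h' q)
  | neg a _ ha =>
    obtain ⟨a', ha', h⟩ := ha
    refine ⟨-a', neg_mem ha', fun q => ?_⟩
    exact congrArg (- ·) (h q)

/-- Condition (FS) passes to the quotient system. -/
lemma quot_FS (X : RSystem R P Q) (hX : X.FS) (I : TwoSidedIdeal R) (hI : X.Invariant I) :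
    (X.quot hX I hI).FS := by
  classical
  intro s t
  constructor
  · obtain ⟨Θ, hΘ, h⟩ := (hX (s.image Quotient.out) ∅).1
    obtain ⟨Θ', hΘ', h'⟩ := X.quot_finRank hX I hI hΘ
    refine ⟨Θ', hΘ', fun q hq => ?_⟩
    have h1 := h' (Quotient.out q)
    rw [h _ (Finset.mem_image_of_mem _ hq)] at h1
    have h2 : ((Quotient.out q : Q) : X.QQuot I) = q := Quotient.out_eq' q
    rwa [h2] at h1
  · obtain ⟨Θ, hΘ, h⟩ := (hX ∅ (t.image Quotient.out)).2
    obtain ⟨Θ', hΘ', h'⟩ := X.quot_finRank' hX I hI hΘ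
    refine ⟨Θ', hΘ', fun q hq => ?_⟩
    have h1 := h' (Quotient.out q)
    rw [h _ (Finset.mem_image_of_mem _ hq)] at h1
    have h2 : ((Quotient.out q : P) : X.PQuot I) = q := Quotient.out_eq' q
    rwa [h2] at h1

/-- The two-sided ideal `J_I = ℘_I(J)` of `R_I = R / I`. -/
def idealQuot (I J : TwoSidedIdeal R) : TwoSidedIdeal I.ringCon.Quotient :=
  TwoSidedIdeal.mk' (quotHom I.ringCon '' (J : Set R))
    ⟨0, J.zero_mem, map_zero _⟩
    (by rintro _ _ ⟨x, hx, rfl⟩ ⟨y, hy, rfl⟩; exact ⟨x + y, J.add_mem hx hy, map_add _ _ _⟩)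
    (by rintro _ ⟨x, hx, rfl⟩; exact ⟨-x, J.neg_mem hx, map_neg _ _⟩)
    (by
      rintro a _ ⟨x, hx, rfl⟩
      obtain ⟨r, rfl⟩ := quotHom_surjective _ a
      exact ⟨r * x, J.mul_mem_left _ _ hx, map_mul _ _ _⟩)
    (by
      rintro _ a ⟨x, hx, rfl⟩
      obtain ⟨r, rfl⟩ := quotHom_surjective _ a
      exact ⟨x * r, J.mul_mem_right _ _ hx, map_mul _ _ _⟩)

/-! ### `T`-pairs -/

/-- A pair `ω = (I, J)` of two-sided ideals with `I ⊆ J` is a `T`-pair if `I` is `ψ`-invariant and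
`J_I` is a faithful `ψ_I`-compatible ideal of `R_I`. -/
structure IsTPair (X : RSystem R P Q) (hX : X.FS) (ω : TwoSidedIdeal R × TwoSidedIdeal R) :
    Prop where
  le : ω.1 ≤ ω.2
  invariant : X.Invariant ω.1
  compatible : (X.quot hX ω.1 invariant).Compatible (idealQuot ω.1 ω.2)
  faithful : (X.quot hX ω.1 invariant).Faithful (idealQuot ω.1 ω.2)

section TPair

variable (X : RSystem R P Q) (hX : X.FS) {ω : TwoSidedIdeal R × TwoSidedIdeal R}
  (hω : X.IsTPair hX ω)

/-- The ring `O_{(_I P, Q_I, ψ_I)}(J_I)` of the `T`-pair `ω = (I, J)`. -/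
abbrev TPairRing : Type _ :=
  (X.quot hX ω.1 hω.invariant).CPRing (X.quot_FS hX ω.1 hω.invariant) (idealQuot ω.1 ω.2)
    hω.compatible

/-- The covariant representation `(ι_P^ω, ι_Q^ω, ι_R^ω, O_{(_I P, Q_I, ψ_I)}(J_I))` of
`(P, Q, ψ)`: the Cuntz-Pimsner representation of `(_I P, Q_I, ψ_I)` relative to `J_I`, composed
with the quotient maps `℘_I`. -/
noncomputable def tPairRep : CovRep X (X.TPairRing hX hω) :=
  let κ := (X.quot hX ω.1 hω.invariant).cpRep (X.quot_FS hX ω.1 hω.invariant)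
    (idealQuot ω.1 ω.2) hω.compatible
  { S := κ.S.comp (QuotientAddGroup.mk' (X.IP ω.1))
    T := κ.T.comp (QuotientAddGroup.mk' (X.QI ω.1))
    σ := κ.σ.comp (quotHom ω.1.ringCon)
    S_right := fun r p => κ.S_right (quotHom ω.1.ringCon r) (p : X.PQuot ω.1)
    S_left := fun r p => κ.S_left (quotHom ω.1.ringCon r) (p : X.PQuot ω.1)
    T_right := fun r q => κ.T_right (quotHom ω.1.ringCon r) (q : X.QQuot ω.1)
    T_left := fun r q => κ.T_left (quotHom ω.1.ringCon r) (q : X.QQuot ω.1)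
    σ_ψ := fun p q => κ.σ_ψ (p : X.PQuot ω.1) (q : X.QQuot ω.1) }

end TPair

end RSystem

/-- The ring homomorphism `η` maps the representation `(S₁, T₁, σ₁, B₁)` to `(S₂, T₂, σ₂, B₂)`:
`η ∘ σ₁ = σ₂`, `η ∘ T₁ = T₂` and `η ∘ S₁ = S₂`. -/
def CovRep.IsMorphism {R P Q : Type*} [NonUnitalRing R] [AddCommGroup P] [AddCommGroup Q]
    {X : RSystem R P Q} {B₁ B₂ : Type*} [NonUnitalRing B₁] [NonUnitalRing B₂]
    (ρ₁ : CovRep X B₁) (ρ₂ : CovRep X B₂) (η : B₁ →ₙ+* B₂) : Prop :=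
  (∀ r, η (ρ₁.σ r) = ρ₂.σ r) ∧ (∀ q, η (ρ₁.T q) = ρ₂.T q) ∧ (∀ p, η (ρ₁.S p) = ρ₂.S p)

end CuntzPimsner

/-! Everything rests on two equalities: the representation attached to a T-pair (I, J) has exactly I
as the kernel of σ (`tPairRep_idealI`) and exactly J as the ideal of elements r with σ(r) in the
image of π (`tPairRep_idealJ`). Homomorphisms can only enlarge these two ideals, and injective ones
preserve them. This gives (1) and the condition on ω in (3).

For (2), a representation whose σ kills I factors through the quotient system. The Cuntz-Pimsner
relations on J then hold automatically: by (FS) an element of B S(P) that annihilates T(Q) from the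
left is zero, so σ(r), once it lies in the image of π, must equal π(Δ(r)) (`CovRep.σ_eq_TS`).
Uniqueness holds because the generators determine the homomorphism.

For (3), one direction transports the gauge grading. The universal property applied to Laurent
polynomials over B gives a coaction, and its homogeneous elements grade B
(`CovRep.graded_of_coaction`). The other direction is the graded uniqueness theorem
`CovRep.IsMorphism.injective_of_graded`. Since the target is graded, it is enough to treat
homogeneous elements; multiplying by S(P) or T(Q) reduces to degree zero, and there one inducts on
word length, the equality of the J-ideals being what removes the σ(R)-term. The final claim takes ω
to be the pair of the given representation, which is a T-pair by `isTPair_pair`.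

The two equalities come from a Fock representation of the Toeplitz ring on functions of words in P,
with values in the unitization of R so that a vacuum vector exists. For x in J, the element ι(x) −
π(Δ(x)) acts only on the empty word, by multiplication by x. Hence the whole ideal T(J) produces
J-valued vectors of finite length. Evaluating at the vacuum gives the upper bound for J. If σ(r)
vanishes in the quotient, r acts with a uniform length bound, and faithfulness of J removes one
letter at a time until r = 0. -/

namespace CuntzPimsner

open scoped Pointwise

/-! ### Lifting homomorphisms to quotients by congruences -/

/-- A ring homomorphism that respects a congruence factors through the quotient. -/
def conLift {A C : Type*} [NonUnitalRing A] [NonUnitalRing C] (c : RingCon A) (f : A →ₙ+* C)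
    (h : ∀ a b, c a b → f a = f b) : c.Quotient →ₙ+* C where
  toFun := Quotient.lift (s := c.toSetoid) f h
  map_zero' := map_zero f
  map_add' x y := Quotient.inductionOn₂' x y fun a b => map_add f a b
  map_mul' x y := Quotient.inductionOn₂' x y fun a b => map_mul f a b

/-- The relation f a = f b is itself a congruence, so it contains the one generated by r. -/
lemma ringCon_of_ringConGen {A C : Type*} [NonUnitalRing A] [NonUnitalRing C]
    {r : A → A → Prop} (f : A →ₙ+* C) (h : ∀ a b, r a b → f a = f b) (a b : A)
    (hab : ringConGen r a b) : f a = f b := by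
  change RingConGen.Rel r a b at hab
  induction hab with
  | of a b h' => exact h a b h'
  | refl => rfl
  | symm _ ih => exact ih.symm
  | trans _ _ ih ih' => exact ih.trans ih'
  | add _ _ ih ih' => rw [map_add, map_add, ih, ih']
  | mul _ _ ih ih' => rw [map_mul, map_mul, ih, ih']

lemma quotHom_eq_iff {A : Type*} [NonUnitalRing A] (I : TwoSidedIdeal A) (a b : A) :
    quotHom I.ringCon a = quotHom I.ringCon b ↔ a - b ∈ I :=
  (RingCon.eq _).trans (I.rel_iff a b)

/-! ### Consequences of condition (FS) for covariant representations -/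

namespace RSystem

variable {R P Q : Type*} [NonUnitalRing R] [AddCommGroup P] [AddCommGroup Q] (X : RSystem R P Q)

/-- Condition (FS) makes ψ nondegenerate: q = Θ(q), and Θ(q) is a sum of terms q'ψ(p ⊗ q) up to
sign. -/
lemma eq_zero_of_ψ_left (hX : X.FS) {q : Q} (h : ∀ p, X.ψ p q = 0) : q = 0 := by
  obtain ⟨Θ, hΘ, hq⟩ := (hX {q} ∅).1
  rw [← hq q (Finset.mem_singleton_self q)]
  clear hq
  induction hΘ using AddSubgroup.closure_induction with
  | mem x hx =>
    obtain ⟨q', p, rfl⟩ := hx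
    change X.modQ.right (X.ψ p q) q' = 0
    rw [h p]; simp
  | zero => rfl
  | add x y _ _ hx hy => change x q + y q = 0; rw [hx, hy, add_zero]
  | neg x _ hx => change -(x q) = 0; rw [hx, neg_zero]

lemma eq_zero_of_ψ_right (hX : X.FS) {p : P} (h : ∀ q, X.ψ p q = 0) : p = 0 := by
  obtain ⟨Ω, hΩ, hp⟩ := (hX ∅ {p}).2
  rw [← hp p (Finset.mem_singleton_self p)]
  clear hp
  induction hΩ using AddSubgroup.closure_induction with
  | mem x hx =>
    obtain ⟨p', q, rfl⟩ := hx
    change X.modP.left (X.ψ p q) p' = 0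
    rw [h q]; simp
  | zero => rfl
  | add x y _ _ hx hy => change x p + y p = 0; rw [hx, hy, add_zero]
  | neg x _ hx => change -(x p) = 0; rw [hx, neg_zero]

end RSystem

namespace CovRep

variable {R P Q : Type*} [NonUnitalRing R] [AddCommGroup P] [AddCommGroup Q]
  {X : RSystem R P Q} {B : Type*} [NonUnitalRing B]

/-- Since T(q'ψ(p ⊗ q)) = T(q')S(p)T(q), finite rank operators on Q become left multiplications in
B. -/
lemma T_thetaHom (ρ : CovRep X B) (t : TensorProduct ℤ Q P) (q : Q) :
    ρ.T (X.thetaHom t q) = ρ.TS t * ρ.T q := by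
  induction t using TensorProduct.induction_on with
  | zero => simp
  | tmul a b =>
    have h' : X.theta a b q = X.modQ.right (X.ψ b q) a := rfl
    rw [RSystem.thetaHom_tmul, h', TS_tmul, ρ.T_right, ρ.σ_ψ, mul_assoc]
  | add x y hx hy =>
    have h : (X.thetaHom (x + y)) q = X.thetaHom x q + X.thetaHom y q := by rw [map_add]; rfl
    rw [h, map_add, map_add, hx, hy, add_mul]

/-- Under T, condition (FS) supplies left local units for T(Q) inside the image of π. -/
lemma exists_TS_mul_T (ρ : CovRep X B) (hX : X.FS) (s : Finset Q) :
    ∃ t, ∀ q ∈ s, ρ.TS t * ρ.T q = ρ.T q := by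
  obtain ⟨Θ, hΘ, h⟩ := (hX s ∅).1
  obtain ⟨t, rfl⟩ := (X.mem_finRank_iff Θ).1 hΘ
  exact ⟨t, fun q hq => by rw [← T_thetaHom, h q hq]⟩

/-- Since S(ψ(y ⊗ q)p) = S(y)T(q)S(p), finite rank operators on P become right multiplications by
elements of the image of π. -/
lemma exists_S_finRank' (ρ : CovRep X B) {Ω : AddMonoid.End P} (hΩ : Ω ∈ X.finRank') :
    ∃ t, ∀ p, ρ.S (Ω p) = ρ.S p * ρ.TS t := by
  induction hΩ using AddSubgroup.closure_induction with
  | mem x hx =>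
    obtain ⟨p, q, rfl⟩ := hx
    refine ⟨TensorProduct.tmul ℤ q p, fun y => ?_⟩
    have h : X.theta' p q y = X.modP.left (X.ψ y q) p := rfl
    rw [h, ρ.S_left, ρ.σ_ψ, TS_tmul, mul_assoc]
  | zero => exact ⟨0, fun p => by simp⟩
  | add x y _ _ hx hy =>
    obtain ⟨a, ha⟩ := hx
    obtain ⟨b, hb⟩ := hy
    refine ⟨a + b, fun p => ?_⟩
    have h : (x + y) p = x p + y p := rfl
    rw [h, map_add, map_add, mul_add, ha, hb]
  | neg x _ hx =>
    obtain ⟨a, ha⟩ := hx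
    refine ⟨-a, fun p => ?_⟩
    have h : (-x) p = -(x p) := rfl
    rw [h, map_neg, map_neg, mul_neg, ha]

lemma exists_S_mul_TS (ρ : CovRep X B) (hX : X.FS) (s : Finset P) :
    ∃ t, ∀ p ∈ s, ρ.S p * ρ.TS t = ρ.S p := by
  obtain ⟨Ω, hΩ, h⟩ := (hX ∅ s).2
  obtain ⟨t, ht⟩ := ρ.exists_S_finRank' hΩ
  exact ⟨t, fun p hp => by rw [← ht, h p hp]⟩

/-! ### Local units and annihilators in B -/

/-- The image of `Q`, as an additive submonoid. -/
abbrev rangeT (ρ : CovRep X B) : AddSubmonoid B := AddMonoidHom.mrange ρ.T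

/-- The image of `P`, as an additive submonoid. -/
abbrev rangeS (ρ : CovRep X B) : AddSubmonoid B := AddMonoidHom.mrange ρ.S

/-- The image of `R`, as an additive submonoid. -/
abbrev rangeσ (ρ : CovRep X B) : AddSubmonoid B := AddMonoidHom.mrange (ρ.σ : R →+ B)

lemma T_mem (ρ : CovRep X B) (q : Q) : ρ.T q ∈ ρ.rangeT := ⟨q, rfl⟩
lemma S_mem (ρ : CovRep X B) (p : P) : ρ.S p ∈ ρ.rangeS := ⟨p, rfl⟩
lemma σ_mem (ρ : CovRep X B) (r : R) : ρ.σ r ∈ ρ.rangeσ := ⟨r, rfl⟩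

lemma TS_mem (ρ : CovRep X B) (t : TensorProduct ℤ Q P) : ρ.TS t ∈ ρ.rangeT * ρ.rangeS := by
  induction t using TensorProduct.induction_on with
  | zero => rw [map_zero]; exact zero_mem _
  | tmul q p => exact AddSubmonoid.mul_mem_mul (ρ.T_mem q) (ρ.S_mem p)
  | add x y hx hy => rw [map_add]; exact add_mem hx hy

lemma exists_TS_mul (ρ : CovRep X B) (hX : X.FS) {x : B}
    (hx : x ∈ ρ.rangeT * (⊤ : AddSubmonoid B)) :
    ∃ t, ρ.TS t * x = x := by
  classical
  -- The finite set is found before the local unit: finite sets can be united over the summands of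
  -- x, whereas local units chosen for separate summands cannot be merged.
  obtain ⟨s, hs⟩ : ∃ s : Finset Q, ∀ t, (∀ q ∈ s, ρ.TS t * ρ.T q = ρ.T q) → ρ.TS t * x = x := by
    refine AddSubmonoid.mul_induction_on hx ?_ ?_
    · rintro _ ⟨q, rfl⟩ n -
      exact ⟨{q}, fun t h => by rw [← mul_assoc, h q (by simp)]⟩
    · intro x y hx hy
      obtain ⟨a, ha⟩ := hx
      obtain ⟨b, hb⟩ := hy
      exact ⟨a ∪ b, fun t h => by
        rw [mul_add, ha t fun q hq => h q (by simp [hq]), hb t fun q hq => h q (by simp [hq])]⟩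
  obtain ⟨t, ht⟩ := ρ.exists_TS_mul_T hX s
  exact ⟨t, hs t ht⟩

lemma exists_mul_TS (ρ : CovRep X B) (hX : X.FS) {x : B}
    (hx : x ∈ (⊤ : AddSubmonoid B) * ρ.rangeS) :
    ∃ t, x * ρ.TS t = x := by
  classical
  obtain ⟨s, hs⟩ : ∃ s : Finset P, ∀ t, (∀ p ∈ s, ρ.S p * ρ.TS t = ρ.S p) → x * ρ.TS t = x := by
    refine AddSubmonoid.mul_induction_on hx ?_ ?_
    · rintro m - _ ⟨p, rfl⟩
      exact ⟨{p}, fun t h => by rw [mul_assoc, h p (by simp)]⟩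
    · intro x y hx hy
      obtain ⟨a, ha⟩ := hx
      obtain ⟨b, hb⟩ := hy
      exact ⟨a ∪ b, fun t h => by
        rw [add_mul, ha t fun q hq => h q (by simp [hq]), hb t fun q hq => h q (by simp [hq])]⟩
  obtain ⟨t, ht⟩ := ρ.exists_S_mul_TS hX s
  exact ⟨t, hs t ht⟩

/-- A local unit writes x as a sum of terms T(q)S(p)x, and each of these vanishes. -/
lemma eq_zero_of_S_mul (ρ : CovRep X B) (hX : X.FS) {x : B}
    (hx : x ∈ ρ.rangeT * (⊤ : AddSubmonoid B)) (h : ∀ p, ρ.S p * x = 0) : x = 0 := by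
  obtain ⟨t, ht⟩ := ρ.exists_TS_mul hX hx
  rw [← ht]
  clear ht
  induction t using TensorProduct.induction_on with
  | zero => simp
  | tmul q p => rw [TS_tmul, mul_assoc, h, mul_zero]
  | add a b ha hb => rw [map_add, add_mul, ha, hb, add_zero]

lemma eq_zero_of_mul_T (ρ : CovRep X B) (hX : X.FS) {x : B}
    (hx : x ∈ (⊤ : AddSubmonoid B) * ρ.rangeS) (h : ∀ q, x * ρ.T q = 0) : x = 0 := by
  obtain ⟨t, ht⟩ := ρ.exists_mul_TS hX hx
  rw [← ht]
  clear ht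
  induction t using TensorProduct.induction_on with
  | zero => simp
  | tmul q p => rw [TS_tmul, ← mul_assoc, h, zero_mul]
  | add a b ha hb => rw [map_add, mul_add, ha, hb, add_zero]

lemma TS_mem_right (ρ : CovRep X B) (t : TensorProduct ℤ Q P) :
    ρ.TS t ∈ (⊤ : AddSubmonoid B) * ρ.rangeS :=
  AddSubmonoid.mul_le_mul_left le_top (ρ.TS_mem t)

lemma TS_mem_left (ρ : CovRep X B) (t : TensorProduct ℤ Q P) :
    ρ.TS t ∈ ρ.rangeT * (⊤ : AddSubmonoid B) :=
  AddSubmonoid.mul_le_mul_right le_top (ρ.TS_mem t)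

lemma mem_idealJ_iff (ρ : CovRep X B) (hX : X.FS) (r : R) :
    r ∈ ρ.idealJ hX ↔ ∃ t, ρ.σ r = ρ.TS t := by
  rw [← ρ.exists_pi_iff hX, idealJ, TwoSidedIdeal.mem_mk']
  rfl

lemma mem_idealI_iff (ρ : CovRep X B) (r : R) : r ∈ ρ.idealI ↔ ρ.σ r = 0 :=
  TwoSidedIdeal.mem_ker _

/-- If `σ(r)` lies in the image of `π`, it is the image of any `t` representing `Δ(r)`, up to the
kernel of `T`. -/
lemma σ_eq_TS (ρ : CovRep X B) (hX : X.FS) {r : R} (hr : r ∈ ρ.idealJ hX)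
    {t : TensorProduct ℤ Q P} (ht : ∀ q, ρ.T (X.modQ.left r q) = ρ.T (X.thetaHom t q)) :
    ρ.σ r = ρ.TS t := by
  obtain ⟨u, hu⟩ := (ρ.mem_idealJ_iff hX r).1 hr
  rw [hu, ← sub_eq_zero, ← map_sub]
  -- Two candidates for σ(r) in the image of π differ by an element of B S(P), so they agree once
  -- they act equally on T(Q).
  refine ρ.eq_zero_of_mul_T hX (ρ.TS_mem_right _) fun q => ?_
  rw [map_sub, sub_mul, ← hu, ← ρ.T_left, ht, T_thetaHom, sub_self]

/-- A morphism of covariant representations intertwines the maps `q ⊗ p ↦ T(q) S(p)`. -/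
lemma IsMorphism.map_TS {C : Type*} [NonUnitalRing C] {ρ : CovRep X B} {ρ' : CovRep X C}
    {η : B →ₙ+* C} (h : ρ.IsMorphism ρ' η) (t : TensorProduct ℤ Q P) :
    η (ρ.TS t) = ρ'.TS t := by
  induction t using TensorProduct.induction_on with
  | zero => simp
  | tmul q p => rw [TS_tmul, TS_tmul, map_mul, h.2.1, h.2.2]
  | add a b ha hb => rw [map_add, map_add, map_add, ha, hb]

/-! ### Surjective representations are determined by generators -/

lemma Surjective.induction {ρ : CovRep X B} (hρ : ρ.Surjective) {p : B → Prop}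
    (hσ : ∀ r, p (ρ.σ r)) (hT : ∀ q, p (ρ.T q)) (hS : ∀ x, p (ρ.S x))
    (hadd : ∀ x y, p x → p y → p (x + y)) (hneg : ∀ x, p x → p (-x))
    (hmul : ∀ x y, p x → p y → p (x * y)) (x : B) : p x := by
  have hx : x ∈ NonUnitalSubring.closure (Set.range ρ.σ ∪ Set.range ρ.T ∪ Set.range ρ.S) := by
    rw [show _ = _ from hρ]; trivial
  induction hx using NonUnitalSubring.closure_induction with
  | mem x hx =>
    obtain (⟨r, rfl⟩ | ⟨q, rfl⟩) | ⟨y, rfl⟩ := hx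
    exacts [hσ r, hT q, hS y]
  | zero => rw [← map_zero ρ.σ]; exact hσ 0
  | add x y _ _ hx hy => exact hadd x y hx hy
  | neg x _ hx => exact hneg x hx
  | mul x y _ _ hx hy => exact hmul x y hx hy

lemma Surjective.hom_ext {C : Type*} [NonUnitalRing C] {ρ : CovRep X B} (hρ : ρ.Surjective)
    {ρ' : CovRep X C} {η η' : B →ₙ+* C} (h : ρ.IsMorphism ρ' η) (h' : ρ.IsMorphism ρ' η') :
    η = η' := by
  ext x
  refine hρ.induction (p := fun x => η x = η' x) (fun r => ?_) (fun q => ?_) (fun p => ?_)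
    (fun x y hx hy => ?_) (fun x hx => ?_) (fun x y hx hy => ?_) x
  · rw [h.1, h'.1]
  · rw [h.2.1, h'.2.1]
  · rw [h.2.2, h'.2.2]
  · rw [map_add, map_add, hx, hy]
  · rw [map_neg, map_neg, hx]
  · rw [map_mul, map_mul, hx, hy]

lemma Surjective.map {C : Type*} [NonUnitalRing C] {ρ : CovRep X B} (hρ : ρ.Surjective)
    {ρ' : CovRep X C} {η : B →ₙ+* C} (h : ρ.IsMorphism ρ' η) (hη : Function.Surjective η) :
    ρ'.Surjective := by
  rw [Surjective, eq_top_iff]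
  rintro x -
  obtain ⟨y, rfl⟩ := hη x
  refine hρ.induction (p := fun x => η x ∈ NonUnitalSubring.closure
    (Set.range ρ'.σ ∪ Set.range ρ'.T ∪ Set.range ρ'.S)) (fun r => ?_) (fun q => ?_) (fun p => ?_)
    (fun x y hx hy => ?_) (fun x hx => ?_) (fun x y hx hy => ?_) y
  · rw [h.1]; exact NonUnitalSubring.subset_closure (.inl (.inl ⟨r, rfl⟩))
  · rw [h.2.1]; exact NonUnitalSubring.subset_closure (.inl (.inr ⟨q, rfl⟩))
  · rw [h.2.2]; exact NonUnitalSubring.subset_closure (.inr ⟨p, rfl⟩)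
  · rw [map_add]; exact add_mem hx hy
  · rw [map_neg]; exact neg_mem hx
  · rw [map_mul]; exact mul_mem hx hy

lemma Surjective.surjective {C : Type*} [NonUnitalRing C] {ρ : CovRep X B}
    {ρ' : CovRep X C} (hρ' : ρ'.Surjective) {η : B →ₙ+* C} (h : ρ.IsMorphism ρ' η) :
    Function.Surjective η := by
  refine hρ'.induction (p := fun x => ∃ y, η y = x) (fun r => ⟨_, h.1 r⟩) (fun q => ⟨_, h.2.1 q⟩)
    (fun p => ⟨_, h.2.2 p⟩) ?_ ?_ ?_
  · rintro _ _ ⟨x, rfl⟩ ⟨y, rfl⟩; exact ⟨x + y, map_add _ _ _⟩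
  · rintro _ ⟨x, rfl⟩; exact ⟨-x, map_neg _ _⟩
  · rintro _ _ ⟨x, rfl⟩ ⟨y, rfl⟩; exact ⟨x * y, map_mul _ _ _⟩

end CovRep

/-! ### The universal properties of the Toeplitz and Cuntz-Pimsner rings -/

namespace RSystem

variable {R P Q : Type*} [NonUnitalRing R] [AddCommGroup P] [AddCommGroup Q] (X : RSystem R P Q)
  {B : Type*} [NonUnitalRing B]

lemma toeplitzRep_surjective : X.toeplitzRep.Surjective := by
  rw [CovRep.Surjective, eq_top_iff]
  rintro x -
  obtain ⟨a, rfl⟩ := quotHom_surjective _ x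
  set C := NonUnitalSubring.closure
    (Set.range X.toeplitzRep.σ ∪ Set.range X.toeplitzRep.T ∪ Set.range X.toeplitzRep.S)
  have hgen (g : Gen R P Q) : quotHom (ringConGen X.Rel) (FreeRng.gen g) ∈ C := by
    cases g with
    | r x => exact NonUnitalSubring.subset_closure (.inl (.inl ⟨x, rfl⟩))
    | q x => exact NonUnitalSubring.subset_closure (.inl (.inr ⟨x, rfl⟩))
    | p x => exact NonUnitalSubring.subset_closure (.inr ⟨x, rfl⟩)
  have hword (w : FreeSemigroup (Gen R P Q)) :
      quotHom (ringConGen X.Rel) (MonoidAlgebra.single w 1) ∈ C := by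
    induction w using FreeSemigroup.recOnMul with
    | ih1 g => exact hgen g
    | ih2 g w h h' =>
      have : (MonoidAlgebra.single (FreeSemigroup.of g * w) 1 : FreeRng R P Q) =
          MonoidAlgebra.single (FreeSemigroup.of g) 1 * MonoidAlgebra.single w 1 := by
        rw [MonoidAlgebra.single_mul_single, mul_one]
      rw [this, map_mul]
      exact mul_mem (hgen g) h'
  induction a using MonoidAlgebra.induction_linear with
  | zero => rw [map_zero]; exact zero_mem _
  | add f g hf hg => rw [map_add]; exact add_mem hf hg
  | single w n =>
    have : (MonoidAlgebra.single w n : FreeRng R P Q) = n • MonoidAlgebra.single w 1 := by simp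
    rw [this, map_zsmul]
    exact zsmul_mem (hword w) n

/-- The generators of the free ring, sent to their images under a covariant representation. -/
def genMap (ρ : CovRep X B) : Gen R P Q → B
  | .r x => ρ.σ x
  | .p x => ρ.S x
  | .q x => ρ.T x

/-- The ring homomorphism on the free ring induced by a covariant representation. -/
noncomputable def freeLift (ρ : CovRep X B) : FreeRng R P Q →ₙ+* B :=
  NonUnitalRingHomClass.toNonUnitalRingHom
    (MonoidAlgebra.liftMagma ℤ (FreeSemigroup.lift (X.genMap ρ)))

lemma freeLift_gen (ρ : CovRep X B) (g : Gen R P Q) :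
    X.freeLift ρ (FreeRng.gen g) = X.genMap ρ g := by
  change MonoidAlgebra.liftMagma ℤ (FreeSemigroup.lift (X.genMap ρ))
    (MonoidAlgebra.single (FreeSemigroup.of g) 1) = _
  simp

lemma exists_toeplitz_hom (ρ : CovRep X B) :
    ∃ η : X.Toeplitz →ₙ+* B, X.toeplitzRep.IsMorphism ρ η := by
  refine ⟨conLift _ (X.freeLift ρ) (ringCon_of_ringConGen _ ?_), fun r => ?_, fun q => ?_,
    fun p => ?_⟩
  · intro a b h
    cases h <;> simp only [map_add, map_mul, freeLift_gen, genMap, ρ.S_left, ρ.S_right,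
      ρ.T_left, ρ.T_right, ρ.σ_ψ]
  · exact X.freeLift_gen ρ (.r r)
  · exact X.freeLift_gen ρ (.q q)
  · exact X.freeLift_gen ρ (.p p)

variable (hX : X.FS) (J : TwoSidedIdeal R) (hJ : X.Compatible J)

lemma cpRep_surjective : (X.cpRep hX J hJ).Surjective :=
  X.toeplitzRep_surjective.map (η := quotHom (X.toeplitzIdeal hX J hJ).ringCon)
    ⟨fun _ => rfl, fun _ => rfl, fun _ => rfl⟩ (quotHom_surjective _)

lemma toeplitz_isMorphism_cpRep :
    X.toeplitzRep.IsMorphism (X.cpRep hX J hJ) (quotHom (X.toeplitzIdeal hX J hJ).ringCon) :=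
  ⟨fun _ => rfl, fun _ => rfl, fun _ => rfl⟩

variable {J} in
-- The defining relation of the quotient, phrased with an arbitrary tensor t representing Δ(x),
-- which avoids the choice hidden in `pi`.
lemma cpRep_σ {x : R} (hx : x ∈ J) {t : TensorProduct ℤ Q P} (ht : X.thetaHom t = X.Delta x) :
    (X.cpRep hX J hJ).σ x = (X.cpRep hX J hJ).TS t := by
  rw [← (X.toeplitz_isMorphism_cpRep hX J hJ).map_TS, ← (X.toeplitz_isMorphism_cpRep hX J hJ).1,
    quotHom_eq_iff]
  refine TwoSidedIdeal.subset_span ⟨x, hx, ?_⟩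
  rw [← X.toeplitzRep.pi_thetaHom hX t (ht ▸ hJ x hx)]
  simp only [ht]

lemma toeplitzIdeal_le (K : TwoSidedIdeal X.Toeplitz) (h : ∀ x ∈ J, ∀ t : TensorProduct ℤ Q P,
    X.thetaHom t = X.Delta x → X.toeplitzRep.σ x - X.toeplitzRep.TS t ∈ K) :
    X.toeplitzIdeal hX J hJ ≤ K := by
  refine TwoSidedIdeal.span_le.2 ?_
  rintro _ ⟨x, hx, rfl⟩
  obtain ⟨t, ht⟩ := (X.mem_finRank_iff _).1 (hJ x hx)
  have := h x hx t ht
  rw [← X.toeplitzRep.pi_thetaHom hX t (ht ▸ hJ x hx)] at this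
  simp only [ht] at this
  exact this

/-- The hypothesis says that the induced homomorphism on the Toeplitz ring kills the generators of
T(J), so it descends. -/
lemma exists_cp_hom (ρ : CovRep X B) (h : ∀ x ∈ J, ∀ t : TensorProduct ℤ Q P,
    X.thetaHom t = X.Delta x → ρ.σ x = ρ.TS t) :
    ∃ η : X.CPRing hX J hJ →ₙ+* B, (X.cpRep hX J hJ).IsMorphism ρ η := by
  obtain ⟨φ, hφ⟩ := X.exists_toeplitz_hom ρ
  have hle : X.toeplitzIdeal hX J hJ ≤ TwoSidedIdeal.ker φ := by
    refine X.toeplitzIdeal_le hX J hJ _ fun x hx t ht => ?_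
    rw [TwoSidedIdeal.mem_ker, map_sub, hφ.1, hφ.map_TS, h x hx t ht, sub_self]
  refine ⟨conLift _ φ fun a b hab => ?_, hφ⟩
  rw [← sub_eq_zero, ← map_sub, ← TwoSidedIdeal.mem_ker]
  exact hle ((TwoSidedIdeal.rel_iff _ a b).1 hab)

end RSystem

/-! ### Gradings -/

/-- The sum lifts to the external direct sum, where it is zero by injectivity and can be read
componentwise. -/
lemma eq_zero_of_sum_eq_zero {B : Type*} [AddCommGroup B] {𝓑 : ℤ → AddSubgroup B}
    (h𝓑 : DirectSum.IsInternal 𝓑) (s : Finset ℤ) (f : ℤ → B) (hf : ∀ d, f d ∈ 𝓑 d)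
    (h : ∑ d ∈ s, f d = 0) : ∀ d ∈ s, f d = 0 := by
  intro d hd
  have hz : ∑ e ∈ s, DirectSum.of (fun i => 𝓑 i) e ⟨f e, hf e⟩ = 0 := by
    refine h𝓑.injective ?_
    rw [map_zero, map_sum, ← h]
    exact Finset.sum_congr rfl fun e _ => DirectSum.coeAddMonoidHom_of _ _ _
  have := congrArg (fun z => ((z d : 𝓑 d) : B)) hz
  simp only [DirectSum.sum_apply, DirectSum.zero_apply, AddSubgroup.coe_zero,
    AddSubgroup.val_finsetSum] at this
  rw [Finset.sum_eq_single d, DirectSum.of_eq_same] at this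
  · exact this
  · intro e _ hed
    rw [DirectSum.of_eq_of_ne _ _ _ (Ne.symm hed)]; rfl
  · exact fun h => absurd hd h

namespace CovRep

variable {R P Q : Type*} [NonUnitalRing R] [AddCommGroup P] [AddCommGroup Q]
  {X : RSystem R P Q} {B : Type*} [NonUnitalRing B]

/-- B need not have a unit, so the Laurent coefficients are taken in its unitization. -/
noncomputable instance laurentRing : NonUnitalRing (AddMonoidAlgebra (Unitization ℤ B) ℤ) :=
  AddMonoidAlgebra.nonUnitalRing (R := Unitization ℤ B)

/-- The covariant representation on the Laurent polynomials over `B` in which `Q` has degree `1`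
and `P` has degree `-1`. -/
noncomputable def laurent (ρ : CovRep X B) : CovRep X (AddMonoidAlgebra (Unitization ℤ B) ℤ) where
  S := AddMonoidHom.mk' (fun p => AddMonoidAlgebra.single (-1) (ρ.S p : Unitization ℤ B))
    (fun a b => by rw [map_add, Unitization.inr_add, AddMonoidAlgebra.single_add])
  T := AddMonoidHom.mk' (fun q => AddMonoidAlgebra.single 1 (ρ.T q : Unitization ℤ B))
    (fun a b => by rw [map_add, Unitization.inr_add, AddMonoidAlgebra.single_add])
  σ :=
    { AddMonoidHom.mk' (fun r => AddMonoidAlgebra.single (0 : ℤ) (ρ.σ r : Unitization ℤ B))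
        (fun a b => by rw [map_add, Unitization.inr_add, AddMonoidAlgebra.single_add]) with
      map_mul' := fun a b => by
        change AddMonoidAlgebra.single 0 ((ρ.σ (a * b) : B) : Unitization ℤ B) =
          AddMonoidAlgebra.single 0 _ * AddMonoidAlgebra.single 0 _
        rw [AddMonoidAlgebra.single_mul_single, map_mul, Unitization.inr_mul]; rfl }
  S_right r p := by
    change AddMonoidAlgebra.single _ ((ρ.S _ : B) : Unitization ℤ B) =
      AddMonoidAlgebra.single _ _ * AddMonoidAlgebra.single _ _
    rw [AddMonoidAlgebra.single_mul_single, ρ.S_right, Unitization.inr_mul]; rfl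
  S_left r p := by
    change AddMonoidAlgebra.single _ ((ρ.S _ : B) : Unitization ℤ B) =
      AddMonoidAlgebra.single _ _ * AddMonoidAlgebra.single _ _
    rw [AddMonoidAlgebra.single_mul_single, ρ.S_left, Unitization.inr_mul]; rfl
  T_right r q := by
    change AddMonoidAlgebra.single _ ((ρ.T _ : B) : Unitization ℤ B) =
      AddMonoidAlgebra.single _ _ * AddMonoidAlgebra.single _ _
    rw [AddMonoidAlgebra.single_mul_single, ρ.T_right, Unitization.inr_mul]; rfl
  T_left r q := by
    change AddMonoidAlgebra.single _ ((ρ.T _ : B) : Unitization ℤ B) =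
      AddMonoidAlgebra.single _ _ * AddMonoidAlgebra.single _ _
    rw [AddMonoidAlgebra.single_mul_single, ρ.T_left, Unitization.inr_mul]; rfl
  σ_ψ p q := by
    change AddMonoidAlgebra.single _ ((ρ.σ _ : B) : Unitization ℤ B) =
      AddMonoidAlgebra.single _ _ * AddMonoidAlgebra.single _ _
    rw [AddMonoidAlgebra.single_mul_single, ρ.σ_ψ, Unitization.inr_mul]; rfl

lemma laurent_TS (ρ : CovRep X B) (t : TensorProduct ℤ Q P) :
    ρ.laurent.TS t = AddMonoidAlgebra.single 0 (ρ.TS t : Unitization ℤ B) := by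
  induction t using TensorProduct.induction_on with
  | zero => simp
  | tmul q p =>
    rw [TS_tmul, TS_tmul]
    change AddMonoidAlgebra.single _ _ * AddMonoidAlgebra.single _ _ = _
    rw [AddMonoidAlgebra.single_mul_single, Unitization.inr_mul]; rfl
  | add a b ha hb => rw [map_add, map_add, ha, hb, Unitization.inr_add, AddMonoidAlgebra.single_add]

/-- A surjective covariant representation with a gauge coaction is graded. -/
lemma graded_of_coaction {ρ : CovRep X B} (hρ : ρ.Surjective)
    {δ : B →ₙ+* AddMonoidAlgebra (Unitization ℤ B) ℤ} (hδ : ρ.IsMorphism ρ.laurent δ) :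
    ρ.Graded := by
  -- The spectral subspaces of the coaction: x has degree n when δ(x) is the monomial x tⁿ.
  let 𝓑 : ℤ → AddSubgroup B := fun n =>
    { carrier := {x | δ x = AddMonoidAlgebra.single n (x : Unitization ℤ B)}
      zero_mem' := by simp
      add_mem' := fun {x y} (hx : _ = _) (hy : _ = _) => by
        change δ (x + y) = _
        rw [map_add, hx, hy, Unitization.inr_add, AddMonoidAlgebra.single_add]
      neg_mem' := fun {x} (hx : _ = _) => by
        change δ (-x) = _
        rw [map_neg, hx, neg_eq_iff_add_eq_zero, ← AddMonoidAlgebra.single_add,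
          ← Unitization.inr_add, add_neg_cancel, Unitization.inr_zero, AddMonoidAlgebra.single_zero] }
  have h𝓑 (n : ℤ) (x : B) (hx : x ∈ 𝓑 n) :
    δ x = AddMonoidAlgebra.single n (x : Unitization ℤ B) := hx
  have hmul : ∀ m n, ∀ x ∈ 𝓑 m, ∀ y ∈ 𝓑 n, x * y ∈ 𝓑 (m + n) := by
    intro m n x hx y hy
    change δ (x * y) = _
    rw [map_mul, h𝓑 m x hx, h𝓑 n y hy, AddMonoidAlgebra.single_mul_single, Unitization.inr_mul]
  refine ⟨𝓑, ⟨?_, ?_⟩, hmul, hδ.1, hδ.2.1, hδ.2.2⟩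
  -- The coefficient of δ at t^d recovers the component of degree d, so the sum is direct.
  · have hcoeff (z : DirectSum ℤ fun i => 𝓑 i) (d : ℤ) :
        (δ (DirectSum.coeAddMonoidHom 𝓑 z)).coeff d = ((z d : B) : Unitization ℤ B) := by
      induction z using DirectSum.induction_on with
      | zero => simp
      | of i x =>
        rw [DirectSum.coeAddMonoidHom_of, h𝓑 i x x.2, AddMonoidAlgebra.coeff_single,
          Finsupp.single_apply]
        split_ifs with h
        · subst h; rw [DirectSum.of_eq_same]
        · rw [DirectSum.of_eq_of_ne _ _ _ (Ne.symm h)]; rfl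
      | add z w hz hw =>
        rw [map_add, map_add, AddMonoidAlgebra.coeff_add, Finsupp.add_apply, hz, hw,
          DirectSum.add_apply, AddSubgroup.coe_add, Unitization.inr_add]
    refine (injective_iff_map_eq_zero _).2 fun z hz => ?_
    ext d
    have := hcoeff z d
    rw [hz, map_zero] at this
    exact Unitization.inr_injective (R := ℤ) this.symm
  · have hof (n : ℤ) (x : B) (hx : x ∈ 𝓑 n) : ∃ z, DirectSum.coeAddMonoidHom 𝓑 z = x :=
      ⟨DirectSum.of (fun i => 𝓑 i) n ⟨x, hx⟩, DirectSum.coeAddMonoidHom_of _ _ _⟩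
    -- The generators are homogeneous and sums of homogeneous elements are closed under products, so
    -- they exhaust B.
    refine hρ.induction (fun r => hof 0 _ (hδ.1 r)) (fun q => hof 1 _ (hδ.2.1 q))
      (fun p => hof (-1) _ (hδ.2.2 p)) ?_ ?_ ?_
    · rintro _ _ ⟨x, rfl⟩ ⟨y, rfl⟩; exact ⟨x + y, map_add _ _ _⟩
    · rintro _ ⟨x, rfl⟩; exact ⟨-x, map_neg _ _⟩
    · rintro _ _ ⟨x, rfl⟩ ⟨y, rfl⟩
      induction x using DirectSum.induction_on with
      | zero => exact ⟨0, by simp⟩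
      | add a b ha hb =>
        obtain ⟨z, hz⟩ := ha
        obtain ⟨w, hw⟩ := hb
        exact ⟨z + w, by rw [map_add, map_add, add_mul, hz, hw]⟩
      | of i a =>
        induction y using DirectSum.induction_on with
        | zero => exact ⟨0, by simp⟩
        | add c d hc hd =>
          obtain ⟨z, hz⟩ := hc
          obtain ⟨w, hw⟩ := hd
          exact ⟨z + w, by rw [map_add, map_add, mul_add, hz, hw]⟩
        | of j b =>
          rw [DirectSum.coeAddMonoidHom_of, DirectSum.coeAddMonoidHom_of]
          exact hof _ _ (hmul i j a a.2 b b.2)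

/-! ### The graded uniqueness theorem -/

/-- The span of the products of `m` elements of `T(Q)`, an element of `σ(R)`, and `n` elements of
`S(P)`. -/
def words (ρ : CovRep X B) : ℕ → ℕ → AddSubmonoid B
  | 0, 0 => ρ.rangeσ
  | 0, n + 1 => words ρ 0 n * ρ.rangeS
  | m + 1, n => ρ.rangeT * words ρ m n

variable (ρ : CovRep X B)

/-- The recursion removes letters from S(P) only once none from T(Q) remain; this removes them on
the right at any stage. -/
lemma words_succ_right (m n : ℕ) : ρ.words m (n + 1) = ρ.words m n * ρ.rangeS := by
  induction m with
  | zero => rw [words]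
  | succ m ih => rw [words, ih, words, mul_assoc]

lemma rangeσ_mul_rangeσ : ρ.rangeσ * ρ.rangeσ ≤ ρ.rangeσ := by
  refine AddSubmonoid.mul_le.2 ?_
  rintro _ ⟨r, rfl⟩ _ ⟨s, rfl⟩
  exact ⟨r * s, map_mul ρ.σ r s⟩

lemma rangeσ_mul_rangeT : ρ.rangeσ * ρ.rangeT ≤ ρ.rangeT := by
  refine AddSubmonoid.mul_le.2 ?_
  rintro _ ⟨r, rfl⟩ _ ⟨q, rfl⟩
  exact ⟨_, ρ.T_left r q⟩

lemma rangeS_mul_rangeσ : ρ.rangeS * ρ.rangeσ ≤ ρ.rangeS := by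
  refine AddSubmonoid.mul_le.2 ?_
  rintro _ ⟨p, rfl⟩ _ ⟨r, rfl⟩
  exact ⟨_, ρ.S_right r p⟩

lemma rangeS_mul_rangeT : ρ.rangeS * ρ.rangeT ≤ ρ.rangeσ := by
  refine AddSubmonoid.mul_le.2 ?_
  rintro _ ⟨p, rfl⟩ _ ⟨q, rfl⟩
  exact ⟨_, ρ.σ_ψ p q⟩

/-- Words always contain a factor from σ(R), so T(q) counts as a word only after a local unit
rewrites it inside T(Q)S(P)T(Q), which lies in T(Q)σ(R). -/
lemma rangeT_le (hX : X.FS) : ρ.rangeT ≤ ρ.rangeT * ρ.rangeσ := by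
  rintro _ ⟨q, rfl⟩
  obtain ⟨t, ht⟩ := ρ.exists_TS_mul_T hX {q}
  rw [← ht q (by simp)]
  have := AddSubmonoid.mul_mem_mul (ρ.TS_mem t) (ρ.T_mem q)
  rw [mul_assoc] at this
  exact AddSubmonoid.mul_le_mul_right ρ.rangeS_mul_rangeT this

lemma rangeS_le (hX : X.FS) : ρ.rangeS ≤ ρ.rangeσ * ρ.rangeS := by
  rintro _ ⟨p, rfl⟩
  obtain ⟨t, ht⟩ := ρ.exists_S_mul_TS hX {p}
  rw [← ht p (by simp)]
  have := AddSubmonoid.mul_mem_mul (ρ.S_mem p) (ρ.TS_mem t)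
  rw [← mul_assoc] at this
  exact AddSubmonoid.mul_le_mul_left ρ.rangeS_mul_rangeT this

lemma rangeσ_mul_words (m n : ℕ) : ρ.rangeσ * ρ.words m n ≤ ρ.words m n := by
  cases m with
  | zero =>
    induction n with
    | zero => rw [words]; exact ρ.rangeσ_mul_rangeσ
    | succ n ih => rw [words, ← mul_assoc]; exact AddSubmonoid.mul_le_mul_left ih
  | succ m => rw [words, ← mul_assoc]; exact AddSubmonoid.mul_le_mul_left ρ.rangeσ_mul_rangeT

lemma words_mul_rangeσ (m n : ℕ) : ρ.words m n * ρ.rangeσ ≤ ρ.words m n := by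
  cases n with
  | zero =>
    induction m with
    | zero => rw [words]; exact ρ.rangeσ_mul_rangeσ
    | succ n ih => rw [words, mul_assoc]; exact AddSubmonoid.mul_le_mul_right ih
  | succ m =>
    rw [words_succ_right, mul_assoc]; exact AddSubmonoid.mul_le_mul_right ρ.rangeS_mul_rangeσ

lemma rangeS_mul_words_succ (m n : ℕ) : ρ.rangeS * ρ.words (m + 1) n ≤ ρ.words m n := by
  rw [words, ← mul_assoc]
  exact (AddSubmonoid.mul_le_mul_left ρ.rangeS_mul_rangeT).trans (ρ.rangeσ_mul_words m n)

lemma words_succ_mul_rangeT (m n : ℕ) : ρ.words m (n + 1) * ρ.rangeT ≤ ρ.words m n := by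
  rw [words_succ_right, mul_assoc]
  exact (AddSubmonoid.mul_le_mul_right ρ.rangeS_mul_rangeT).trans (ρ.words_mul_rangeσ m n)

lemma rangeS_mul_words_zero (hX : X.FS) (n : ℕ) :
    ρ.rangeS * ρ.words 0 n ≤ ρ.words 0 (n + 1) := by
  induction n with
  | zero => rw [words, words, words]; exact ρ.rangeS_mul_rangeσ.trans (ρ.rangeS_le hX)
  | succ n ih =>
    rw [words, words, ← mul_assoc]
    exact AddSubmonoid.mul_le_mul_left ih

lemma mul_iSup_words_le {x : AddSubmonoid B} (h : ∀ m n, ∃ m' n', x * ρ.words m n ≤ ρ.words m' n') :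
    x * (⨆ k : ℕ × ℕ, ρ.words k.1 k.2) ≤ ⨆ k : ℕ × ℕ, ρ.words k.1 k.2 := by
  rw [AddSubmonoid.mul_iSup]
  refine iSup_le fun k => ?_
  obtain ⟨m, n, h⟩ := h k.1 k.2
  exact h.trans (le_iSup (fun k : ℕ × ℕ => ρ.words k.1 k.2) (m, n))

variable {ρ} in
-- The products S(P)T(Q) contract into σ(R), so the span of the words is stable under left
-- multiplication by all generators.
lemma Surjective.iSup_words (hρ : ρ.Surjective) (hX : X.FS) :
    ⨆ k : ℕ × ℕ, ρ.words k.1 k.2 = ⊤ := by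
  set W := ⨆ k : ℕ × ℕ, ρ.words k.1 k.2 with hW
  have hle (m n) : ρ.words m n ≤ W := le_iSup (fun k : ℕ × ℕ => ρ.words k.1 k.2) (m, n)
  have hσW : ρ.rangeσ * W ≤ W := ρ.mul_iSup_words_le fun m n => ⟨m, n, ρ.rangeσ_mul_words m n⟩
  have hTW : ρ.rangeT * W ≤ W := ρ.mul_iSup_words_le fun m n => ⟨m + 1, n, by rw [words]⟩
  have hSW : ρ.rangeS * W ≤ W := ρ.mul_iSup_words_le fun m n => by
    cases m with
    | zero => exact ⟨0, n + 1, ρ.rangeS_mul_words_zero hX n⟩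
    | succ m => exact ⟨m, n, ρ.rangeS_mul_words_succ m n⟩
  -- W is a supremum of additive submonoids only, so closure under negation has to be checked.
  have hneg : ∀ x ∈ W, -x ∈ W := by
    have hneg' (m n : ℕ) : ∀ x ∈ ρ.words m n, -x ∈ ρ.words m n := by
      intro x hx
      have hmul {M N : AddSubmonoid B} (hM : ∀ x ∈ M, -x ∈ M) : ∀ x ∈ M * N, -x ∈ M * N := by
        intro x hx
        refine AddSubmonoid.mul_induction_on hx (fun m hm n hn => ?_) fun x y hx hy => ?_
        · rw [← neg_mul]; exact AddSubmonoid.mul_mem_mul (hM m hm) hn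
        · rw [neg_add]; exact add_mem hx hy
      cases m with
      | succ m =>
        rw [words] at hx ⊢
        refine hmul ?_ x hx
        rintro _ ⟨q, rfl⟩
        exact ⟨-q, map_neg _ _⟩
      | zero =>
        induction n generalizing x with
        | zero =>
          rw [words] at hx ⊢
          obtain ⟨r, rfl⟩ := hx
          exact ⟨-r, map_neg _ _⟩
        | succ n ih => rw [words] at hx ⊢; exact hmul ih x hx
    intro x hx
    refine AddSubmonoid.iSup_induction _ (motive := fun x => -x ∈ W) hx
      (fun k x hx => hle k.1 k.2 (hneg' _ _ x hx)) (by simp) fun x y hx hy => ?_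
    rw [neg_add]; exact add_mem hx hy
  rw [eq_top_iff]
  rintro x -
  -- Membership alone does not pass to products; the induction also carries stability of W under
  -- left multiplication by x.
  suffices h : x ∈ W ∧ ∀ w ∈ W, x * w ∈ W from h.1
  refine hρ.induction (p := fun x => x ∈ W ∧ ∀ w ∈ W, x * w ∈ W) (fun r => ⟨?_, fun w hw => ?_⟩)
    (fun q => ⟨?_, fun w hw => ?_⟩) (fun p => ⟨?_, fun w hw => ?_⟩)
    (fun x y hx hy => ⟨add_mem hx.1 hy.1, fun w hw => ?_⟩)
    (fun x hx => ⟨hneg x hx.1, fun w hw => ?_⟩)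
    (fun x y hx hy => ⟨hx.2 y hy.1, fun w hw => ?_⟩) x
  · exact hle 0 0 (by rw [words]; exact ρ.σ_mem r)
  · exact hσW (AddSubmonoid.mul_mem_mul (ρ.σ_mem r) hw)
  · exact hle 1 0 (by rw [words, words]; exact ρ.rangeT_le hX (ρ.T_mem q))
  · exact hTW (AddSubmonoid.mul_mem_mul (ρ.T_mem q) hw)
  · exact hle 0 1 (by rw [words, words]; exact ρ.rangeS_le hX (ρ.S_mem p))
  · exact hSW (AddSubmonoid.mul_mem_mul (ρ.S_mem p) hw)
  · rw [add_mul]; exact add_mem (hx.2 w hw) (hy.2 w hw)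
  · rw [neg_mul]; exact hneg _ (hx.2 w hw)
  · rw [mul_assoc]; exact hx.2 _ (hy.2 w hw)

/-! ### Homogeneous elements -/

/-- The elements of degree `d`. -/
def degree (d : ℤ) : AddSubmonoid B :=
  ⨆ k : {k : ℕ × ℕ // (k.1 : ℤ) - k.2 = d}, ρ.words k.1.1 k.1.2

lemma words_le_degree (m n : ℕ) {d : ℤ} (h : (m : ℤ) - n = d) : ρ.words m n ≤ ρ.degree d :=
  le_iSup (fun k : {k : ℕ × ℕ // (k.1 : ℤ) - k.2 = d} => ρ.words k.1.1 k.1.2) ⟨(m, n), h⟩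

lemma degree_le {d : ℤ} {M : AddSubmonoid B}
    (h : ∀ m n : ℕ, (m : ℤ) - n = d → ρ.words m n ≤ M) : ρ.degree d ≤ M :=
  iSup_le fun k => h _ _ k.2

variable {ρ} in
-- No directness is claimed. Vanishing outside s is recorded so that two such sums can be added over
-- the union of their index sets.
lemma Surjective.exists_sum (hρ : ρ.Surjective) (hX : X.FS) (x : B) :
    ∃ (s : Finset ℤ) (f : ℤ → B), (∀ d, f d ∈ ρ.degree d) ∧ (∀ d ∉ s, f d = 0) ∧
      ∑ d ∈ s, f d = x := by
  classical
  have hx : x ∈ ⨆ k : ℕ × ℕ, ρ.words k.1 k.2 := by rw [hρ.iSup_words hX]; trivial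
  refine AddSubmonoid.iSup_induction _ (motive := fun x => ∃ (s : Finset ℤ) (f : ℤ → B),
    (∀ d, f d ∈ ρ.degree d) ∧ (∀ d ∉ s, f d = 0) ∧ ∑ d ∈ s, f d = x) hx (fun k x hx => ?_)
    ⟨∅, 0, ?_, ?_, ?_⟩ ?_
  · refine ⟨{(k.1 : ℤ) - k.2}, Pi.single ((k.1 : ℤ) - k.2) x, fun d => ?_, fun d hd => ?_, ?_⟩
    · by_cases h : d = (k.1 : ℤ) - k.2
      · subst h; rw [Pi.single_eq_same]; exact ρ.words_le_degree _ _ rfl hx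
      · rw [Pi.single_eq_of_ne h]; exact zero_mem _
    · exact Pi.single_eq_of_ne (by simpa using hd) _
    · simp
  · exact fun _ => zero_mem _
  · exact fun _ _ => rfl
  · simp
  · rintro x y ⟨s, f, hf, hs, rfl⟩ ⟨s', f', hf', hs', rfl⟩
    refine ⟨s ∪ s', f + f', fun d => add_mem (hf d) (hf' d), fun d hd => ?_, ?_⟩
    · rw [Finset.notMem_union] at hd
      rw [Pi.add_apply, hs d hd.1, hs' d hd.2, add_zero]
    · simp only [Pi.add_apply, Finset.sum_add_distrib]
      rw [← Finset.sum_subset Finset.subset_union_left fun d _ h => hs d h,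
        ← Finset.sum_subset Finset.subset_union_right fun d _ h => hs' d h]

/-! ### The filtration of the degree zero part -/

/-- The elements of degree zero which are sums of words of length at most `2k + 1`. -/
def core : ℕ → AddSubmonoid B
  | 0 => ρ.rangeσ
  | k + 1 => ρ.rangeσ ⊔ ρ.rangeT * core k * ρ.rangeS

lemma core_le_succ (k : ℕ) : ρ.core k ≤ ρ.core (k + 1) := by
  induction k with
  | zero => exact le_sup_left
  | succ k ih =>
    refine sup_le_sup le_rfl ?_
    exact AddSubmonoid.mul_le_mul_left (AddSubmonoid.mul_le_mul_right ih)

lemma rangeσ_le_core (k : ℕ) : ρ.rangeσ ≤ ρ.core k := by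
  cases k with
  | zero => exact le_rfl
  | succ k => exact le_sup_left

lemma words_le_core (k : ℕ) : ρ.words k k ≤ ρ.core k := by
  induction k with
  | zero => rw [words, core]
  | succ k ih =>
    rw [words, words_succ_right, ← mul_assoc, core]
    exact le_sup_of_le_right (AddSubmonoid.mul_le_mul_left (AddSubmonoid.mul_le_mul_right ih))

lemma rangeσ_mul_core (k : ℕ) : ρ.rangeσ * ρ.core k ≤ ρ.core k := by
  cases k with
  | zero => exact ρ.rangeσ_mul_rangeσ
  | succ k =>
    rw [core, AddSubmonoid.mul_sup]
    refine sup_le_sup ρ.rangeσ_mul_rangeσ ?_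
    rw [← mul_assoc, ← mul_assoc]
    exact AddSubmonoid.mul_le_mul_left (AddSubmonoid.mul_le_mul_left ρ.rangeσ_mul_rangeT)

lemma core_mul_rangeσ (k : ℕ) : ρ.core k * ρ.rangeσ ≤ ρ.core k := by
  cases k with
  | zero => exact ρ.rangeσ_mul_rangeσ
  | succ k =>
    rw [core, AddSubmonoid.sup_mul]
    refine sup_le_sup ρ.rangeσ_mul_rangeσ ?_
    rw [mul_assoc]
    exact AddSubmonoid.mul_le_mul_right ρ.rangeS_mul_rangeσ

/-- Each outer pair S(P)T(Q) contracts into σ(R), so compressing by S(p) on the left and T(q) on the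
right lowers the filtration by one. -/
lemma core_compress (k : ℕ) : ρ.rangeS * ρ.core (k + 1) * ρ.rangeT ≤ ρ.core k := by
  rw [core, AddSubmonoid.mul_sup, AddSubmonoid.sup_mul]
  refine sup_le ?_ ?_
  · exact ((AddSubmonoid.mul_le_mul_left ρ.rangeS_mul_rangeσ).trans ρ.rangeS_mul_rangeT).trans
      (ρ.rangeσ_le_core k)
  · have : ρ.rangeS * (ρ.rangeT * ρ.core k * ρ.rangeS) * ρ.rangeT =
        (ρ.rangeS * ρ.rangeT) * ρ.core k * (ρ.rangeS * ρ.rangeT) := by simp only [mul_assoc]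
    rw [this]
    calc _ ≤ ρ.rangeσ * ρ.core k * ρ.rangeσ := AddSubmonoid.mul_le_mul
          (AddSubmonoid.mul_le_mul_left ρ.rangeS_mul_rangeT) ρ.rangeS_mul_rangeT
      _ ≤ ρ.core k * ρ.rangeσ := AddSubmonoid.mul_le_mul_left (ρ.rangeσ_mul_core k)
      _ ≤ ρ.core k := ρ.core_mul_rangeσ k

/-- A word of degree zero has equally many letters on both sides, and the filtration is increasing,
so a sum of such words lies in a single stage. -/
lemma exists_mem_core {x : B} (hx : x ∈ ρ.degree 0) : ∃ k, x ∈ ρ.core k := by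
  rw [← AddSubmonoid.mem_iSup_of_directed
    (monotone_nat_of_le_succ ρ.core_le_succ).directed_le]
  refine ρ.degree_le (fun m n h => ?_) hx
  obtain rfl : m = n := by omega
  exact (ρ.words_le_core m).trans (le_iSup ρ.core m)

/-! ### Injectivity on homogeneous elements -/

variable {C : Type*} [NonUnitalRing C] {ρ} {ρ' : CovRep X C} {η : B →ₙ+* C}

/-- Write x = σ(r) + y with y in T(Q)·core·S(P). If η(x) = 0, then r lies in the J-ideal of the
target, hence in that of the source. So x lies in T(Q)B and in B S(P), where it is detected by its
compressions S(p)xT(q), and these belong to the previous stage. -/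
lemma IsMorphism.eq_zero_of_mem_core (h : ρ.IsMorphism ρ' η) (hX : X.FS)
    (hσ : ∀ r, ρ'.σ r = 0 → ρ.σ r = 0) (hJ : ρ'.idealJ hX ≤ ρ.idealJ hX) (k : ℕ) :
    ∀ x ∈ ρ.core k, η x = 0 → x = 0 := by
  induction k with
  | zero =>
    rintro _ ⟨r, rfl⟩ hx
    exact hσ r ((h.1 r).symm.trans hx)
  | succ k ih =>
    intro x hx hηx
    obtain ⟨_, ⟨r, rfl⟩, y, hy, hxy⟩ := AddSubmonoid.mem_sup.1 (show x ∈ _ ⊔ _ from hx)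
    change ρ.σ r + y = x at hxy
    have hyT : y ∈ ρ.rangeT * (⊤ : AddSubmonoid B) := by
      rw [mul_assoc] at hy
      exact AddSubmonoid.mul_le_mul_right le_top hy
    have hyS : y ∈ (⊤ : AddSubmonoid B) * ρ.rangeS := AddSubmonoid.mul_le_mul_left le_top hy
    obtain ⟨t, ht⟩ := ρ.exists_TS_mul hX hyT
    -- A left local unit for y also fixes σ'(r) = −η(y), and its product with σ'(r) stays in the
    -- image of π.
    have hr : r ∈ ρ'.idealJ hX := by
      have h1 : ρ'.σ r = -η y := by
        rw [← hxy, map_add, h.1] at hηx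
        exact eq_neg_of_add_eq_zero_left hηx
      obtain ⟨t', ht'⟩ := ρ'.TS_mul r t
      refine (ρ'.mem_idealJ_iff hX r).2 ⟨t', ?_⟩
      rw [← ht', h1, mul_neg, ← h.map_TS, ← map_mul, ht]
    obtain ⟨u, hu⟩ := (ρ.mem_idealJ_iff hX r).1 (hJ hr)
    have hxT : x ∈ ρ.rangeT * (⊤ : AddSubmonoid B) := by
      rw [← hxy, hu]; exact add_mem (ρ.TS_mem_left u) hyT
    have hxS : x ∈ (⊤ : AddSubmonoid B) * ρ.rangeS := by
      rw [← hxy, hu]; exact add_mem (ρ.TS_mem_right u) hyS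
    refine ρ.eq_zero_of_S_mul hX hxT fun p => ρ.eq_zero_of_mul_T hX ?_ fun q => ?_
    · have := AddSubmonoid.mul_mem_mul (AddSubmonoid.mem_top (ρ.S p)) hxS
      rw [← mul_assoc] at this
      exact AddSubmonoid.mul_le_mul_left le_top this
    · refine ih _ (ρ.core_compress k (AddSubmonoid.mul_mem_mul
        (AddSubmonoid.mul_mem_mul (ρ.S_mem p) hx) (ρ.T_mem q))) ?_
      rw [map_mul, map_mul, hηx, mul_zero, zero_mul]

/-- Positive degrees are lowered by S(p) on the left, negative ones raised by T(q) on the right. By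
(FS) neither family of multiplications loses a nonzero element of its degree. -/
lemma IsMorphism.eq_zero_of_mem_degree (h : ρ.IsMorphism ρ' η) (hX : X.FS)
    (hσ : ∀ r, ρ'.σ r = 0 → ρ.σ r = 0) (hJ : ρ'.idealJ hX ≤ ρ.idealJ hX) (d : ℤ) :
    ∀ x ∈ ρ.degree d, η x = 0 → x = 0 := by
  have h0 : ∀ x ∈ ρ.degree 0, η x = 0 → x = 0 := fun x hx => by
    obtain ⟨k, hk⟩ := ρ.exists_mem_core hx
    exact h.eq_zero_of_mem_core hX hσ hJ k x hk
  induction d with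
  | zero => exact h0
  | succ d ih =>
    intro x hx hηx
    have h1 : ρ.degree (d + 1) ≤ ρ.rangeT * (⊤ : AddSubmonoid B) := by
      refine ρ.degree_le fun m n hmn => ?_
      obtain ⟨m, rfl⟩ : ∃ m', m = m' + 1 := ⟨m - 1, by omega⟩
      rw [words]
      exact AddSubmonoid.mul_le_mul_right le_top
    have h2 : ρ.rangeS * ρ.degree (d + 1) ≤ ρ.degree d := by
      rw [degree, AddSubmonoid.mul_iSup]
      refine iSup_le fun ⟨⟨m, n⟩, hmn⟩ => ?_
      dsimp only at hmn ⊢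
      obtain ⟨m, rfl⟩ : ∃ m', m = m' + 1 := ⟨m - 1, by omega⟩
      exact (ρ.rangeS_mul_words_succ m n).trans (ρ.words_le_degree m n (by omega))
    refine ρ.eq_zero_of_S_mul hX (h1 hx) fun p => ih _ ?_ ?_
    · exact h2 (AddSubmonoid.mul_mem_mul (ρ.S_mem p) hx)
    · rw [map_mul, hηx, mul_zero]
  | pred d ih =>
    intro x hx hηx
    have h1 : ρ.degree (-d - 1) ≤ (⊤ : AddSubmonoid B) * ρ.rangeS := by
      refine ρ.degree_le fun m n hmn => ?_
      obtain ⟨n, rfl⟩ : ∃ n', n = n' + 1 := ⟨n - 1, by omega⟩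
      rw [words_succ_right]
      exact AddSubmonoid.mul_le_mul_left le_top
    have h2 : ρ.degree (-d - 1) * ρ.rangeT ≤ ρ.degree (-d) := by
      rw [degree, AddSubmonoid.iSup_mul]
      refine iSup_le fun ⟨⟨m, n⟩, hmn⟩ => ?_
      dsimp only at hmn ⊢
      obtain ⟨n, rfl⟩ : ∃ n', n = n' + 1 := ⟨n - 1, by omega⟩
      exact (ρ.words_succ_mul_rangeT m n).trans (ρ.words_le_degree m n (by omega))
    refine ρ.eq_zero_of_mul_T hX (h1 hx) fun p => ih _ ?_ ?_
    · exact h2 (AddSubmonoid.mul_mem_mul hx (ρ.T_mem p))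
    · rw [map_mul, hηx, zero_mul]

/-- The graded uniqueness theorem. -/
theorem IsMorphism.injective_of_graded (h : ρ.IsMorphism ρ' η) (hX : X.FS) (hρ : ρ.Surjective)
    (hg : ρ'.Graded) (hσ : ∀ r, ρ'.σ r = 0 → ρ.σ r = 0) (hJ : ρ'.idealJ hX ≤ ρ.idealJ hX) :
    Function.Injective η := by
  obtain ⟨𝓑, h𝓑, hmul, h0, h1, h1'⟩ := hg
  have hwords (m n : ℕ) : ∀ x ∈ ρ.words m n, η x ∈ 𝓑 (m - n) := by
    induction m with
    | zero =>
      induction n with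
      | zero =>
        intro x hx
        rw [words] at hx
        obtain ⟨r, rfl⟩ := hx
        change η (ρ.σ r) ∈ _
        rw [h.1]
        simpa using h0 r
      | succ n ih =>
        intro x hx
        rw [words] at hx
        refine AddSubmonoid.mul_induction_on hx ?_ fun x y hx hy => by
          rw [map_add]; exact add_mem hx hy
        rintro y hy _ ⟨p, rfl⟩
        have := hmul _ _ _ (ih y hy) _ (h1' p)
        rw [map_mul, h.2.2]
        convert this using 2
        push_cast; ring
    | succ m ih =>
      intro x hx
      rw [words] at hx
      refine AddSubmonoid.mul_induction_on hx ?_ fun x y hx hy => by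
        rw [map_add]; exact add_mem hx hy
      rintro _ ⟨q, rfl⟩ y hy
      have := hmul _ _ _ (h1 q) _ (ih y hy)
      rw [map_mul, h.2.1]
      convert this using 2
      push_cast; ring
  have hdeg (d : ℤ) : ∀ x ∈ ρ.degree d, η x ∈ 𝓑 d := by
    intro x hx
    refine AddSubmonoid.iSup_induction _ (motive := fun x => η x ∈ 𝓑 d) hx (fun k x hx => ?_)
      (by simp) fun x y hx hy => by rw [map_add]; exact add_mem hx hy
    rw [← k.2]
    exact hwords _ _ x hx
  refine (injective_iff_map_eq_zero η).2 fun x hx => ?_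
  -- Only the grading of the target is used: it separates the images of the homogeneous summands, so
  -- each image is zero.
  obtain ⟨s, f, hf, -, rfl⟩ := hρ.exists_sum hX x
  rw [map_sum] at hx
  exact Finset.sum_eq_zero fun d hd => h.eq_zero_of_mem_degree hX hσ hJ d _ (hf d)
    (eq_zero_of_sum_eq_zero h𝓑 s (fun d => η (f d)) (fun d => hdeg d _ (hf d)) hx d hd)

end CovRep

/-! ### A Fock representation

The tensor powers of `Q` are replaced by their duals: a vector is a family of functions of words
in `P` with values in the unitization of `R`, balanced and linear in the appropriate sense. -/

namespace RSystem

variable {R P Q : Type*} [NonUnitalRing R] [AddCommGroup P] [AddCommGroup Q] (X : RSystem R P Q)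

/-- The action of `r ∈ R` on functions of words in `P`: it acts from the right on the first letter,
and by multiplication on the value at the empty word. -/
def wordAct (r : R) (f : List P → Unitization ℤ R) : List P → Unitization ℤ R
  | [] => (r : Unitization ℤ R) * f []
  | p :: w => f (X.modP.right r p :: w)

/-- The creation operator of `q ∈ Q` on functions of words in `P`. -/
def create (q : Q) (f : List P → Unitization ℤ R) : List P → Unitization ℤ R
  | [] => 0
  | p :: w => X.wordAct (X.ψ p q) f w

/-- The functions of words in `P` that are additive and `R`-linear in every letter. -/
def fock : AddSubgroup (List P → Unitization ℤ R) where
  carrier := {f |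
    (∀ u p p' w, f (u ++ (p + p') :: w) = f (u ++ p :: w) + f (u ++ p' :: w)) ∧
    (∀ u r p w, f (u ++ X.modP.left r p :: w) = X.wordAct r (fun v => f (u ++ p :: v)) w)}
  zero_mem' := ⟨fun _ _ _ _ => by simp, fun _ _ _ w => by cases w <;> simp [wordAct]⟩
  add_mem' := by
    rintro f g ⟨hf, hf'⟩ ⟨hg, hg'⟩
    refine ⟨fun u p p' w => ?_, fun u r p w => ?_⟩
    · simp only [Pi.add_apply, hf, hg]; abel
    · simp only [Pi.add_apply, hf', hg']
      cases w <;> simp [wordAct, mul_add]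
  neg_mem' := by
    rintro f ⟨hf, hf'⟩
    refine ⟨fun u p p' w => ?_, fun u r p w => ?_⟩
    · simp only [Pi.neg_apply, hf]; abel
    · simp only [Pi.neg_apply, hf']
      cases w <;> simp [wordAct]

variable {X}

lemma fock_add {f : List P → Unitization ℤ R} (hf : f ∈ X.fock) (p p' : P) (w : List P) :
    f ((p + p') :: w) = f (p :: w) + f (p' :: w) := hf.1 [] p p' w

lemma fock_left {f : List P → Unitization ℤ R} (hf : f ∈ X.fock) (r : R) (p : P) (w : List P) :
    f (X.modP.left r p :: w) = X.wordAct r (fun v => f (p :: v)) w := hf.2 [] r p w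

lemma fock_zero {f : List P → Unitization ℤ R} (hf : f ∈ X.fock) (w : List P) :
    f (0 :: w) = 0 := by
  let F : P →+ Unitization ℤ R := AddMonoidHom.mk' (fun p => f (p :: w)) (fock_add hf · · w)
  exact map_zero F

lemma wordAct_mem {f : List P → Unitization ℤ R} (hf : f ∈ X.fock) (r : R) :
    X.wordAct r f ∈ X.fock := by
  refine ⟨fun u p p' w => ?_, fun u s p w => ?_⟩
  · cases u with
    | nil => simp only [List.nil_append, wordAct, map_add, fock_add hf]
    | cons a u => simpa only [List.cons_append, wordAct] using! hf.1 (_ :: u) p p' w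
  · cases u with
    | nil =>
      simp only [List.nil_append, wordAct]
      rw [← X.modP.left_right, fock_left hf]
      cases w <;> rfl
    | cons a u => simpa only [List.cons_append, wordAct] using! hf.2 (_ :: u) s p w

lemma wordAct_add_left {f : List P → Unitization ℤ R} (hf : f ∈ X.fock) (r s : R) :
    X.wordAct (r + s) f = X.wordAct r f + X.wordAct s f := by
  ext1 w
  cases w with
  | nil => simp [wordAct, add_mul]
  | cons p w => simp [wordAct, fock_add hf]

lemma wordAct_mul (f : List P → Unitization ℤ R) (r s : R) :
    X.wordAct (r * s) f = X.wordAct r (X.wordAct s f) := by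
  ext1 w
  cases w with
  | nil =>
    simp only [wordAct, Unitization.inr_mul]
    exact mul_assoc (r : Unitization ℤ R) (s : Unitization ℤ R) (f [])
  | cons p w => simp [wordAct, X.modP.right_mul]

lemma wordAct_add (f g : List P → Unitization ℤ R) (r : R) :
    X.wordAct r (f + g) = X.wordAct r f + X.wordAct r g := by
  ext1 w
  cases w <;> simp [wordAct, mul_add]

lemma create_add (f g : List P → Unitization ℤ R) (q : Q) :
    X.create q (f + g) = X.create q f + X.create q g := by
  ext1 w
  cases w <;> simp [create, wordAct_add]

lemma create_mem {f : List P → Unitization ℤ R} (hf : f ∈ X.fock) (q : Q) :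
    X.create q f ∈ X.fock := by
  refine ⟨fun u p p' w => ?_, fun u s p w => ?_⟩
  · cases u with
    | nil => simp [create, wordAct_add_left hf]
    | cons a u => simpa only [List.cons_append, create] using! (wordAct_mem hf _).1 u p p' w
  · cases u with
    | nil => simp only [List.nil_append, create, X.ψ_left, wordAct_mul]
    | cons a u => simpa only [List.cons_append, create] using! (wordAct_mem hf _).2 u s p w

lemma annihilate_mem {f : List P → Unitization ℤ R} (hf : f ∈ X.fock) (p : P) :
    (fun w => f (p :: w)) ∈ X.fock :=
  ⟨fun u => hf.1 (p :: u), fun u => hf.2 (p :: u)⟩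

variable (X)

/-- The Fock representation of an `R`-system. -/
def fockRep : CovRep X (AddMonoid.End X.fock) where
  S := AddMonoidHom.mk' (fun p => AddMonoidHom.mk' (fun f => ⟨_, annihilate_mem f.2 p⟩)
      fun f g => rfl)
    fun p p' => by ext f : 2; ext1 w; exact fock_add f.2 p p' w
  T := AddMonoidHom.mk' (fun q => AddMonoidHom.mk' (fun f => ⟨_, create_mem f.2 q⟩)
      fun f g => Subtype.ext (create_add _ _ q))
    fun q q' => by
      ext f : 2; ext1 w
      cases w with
      | nil => exact (add_zero (0 : Unitization ℤ R)).symm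
      | cons p w =>
        change X.wordAct (X.ψ p (q + q')) f w = X.wordAct (X.ψ p q) f w + X.wordAct (X.ψ p q') f w
        rw [map_add, wordAct_add_left f.2]; rfl
  σ :=
    { AddMonoidHom.mk' (fun r => AddMonoidHom.mk' (fun f => ⟨_, wordAct_mem f.2 r⟩)
        fun f g => Subtype.ext (wordAct_add _ _ r))
      fun r s => by ext f : 2; exact wordAct_add_left f.2 r s with
      map_mul' := fun r s => by ext f : 2; exact wordAct_mul f.1 r s }
  S_right r p := rfl
  S_left r p := by ext f : 2; ext1 w; exact fock_left f.2 r p w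
  T_right r q := by
    ext f : 2; ext1 w
    cases w with
    | nil => rfl
    | cons p w =>
      change X.wordAct (X.ψ p (X.modQ.right r q)) f w = X.wordAct (X.ψ p q) (X.wordAct r f) w
      rw [X.ψ_right, wordAct_mul]
  T_left r q := by
    ext f : 2; ext1 w
    cases w with
    | nil => exact (mul_zero _).symm
    | cons p w =>
      change X.wordAct (X.ψ p (X.modQ.left r q)) f w =
        X.wordAct (X.ψ (X.modP.right r p) q) f w
      rw [X.ψ_balanced]
  σ_ψ p q := rfl

lemma fockRep_T_nil (q : Q) (f : X.fock) :
    (X.fockRep.T q f : List P → Unitization ℤ R) [] = 0 := rfl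

/-- The operator applied last is a creation operator, and its output vanishes at the empty word. -/
lemma fockRep_TS_nil (t : TensorProduct ℤ Q P) (f : X.fock) :
    (X.fockRep.TS t f : List P → Unitization ℤ R) [] = 0 := by
  induction t using TensorProduct.induction_on with
  | zero => rw [map_zero]; rfl
  | tmul q p => rfl
  | add a b ha hb =>
    rw [map_add]
    change (X.fockRep.TS a f).1 [] + (X.fockRep.TS b f).1 [] = 0
    rw [ha, hb, add_zero]

/-- On words of positive length a finite rank operator acts through its adjoint. -/
lemma exists_fockRep_TS_cons (t : TensorProduct ℤ Q P) :
    ∃ Ω : P → P, (∀ p q, X.ψ (Ω p) q = X.ψ p (X.thetaHom t q)) ∧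
      ∀ (f : X.fock) p w, (X.fockRep.TS t f : List P → Unitization ℤ R) (p :: w) =
        f.1 (Ω p :: w) := by
  induction t using TensorProduct.induction_on with
  | zero =>
    refine ⟨0, fun p q => ?_, fun f p w => ?_⟩
    · simp
    · rw [map_zero, Pi.zero_apply, fock_zero f.2]; rfl
  | tmul q p' =>
    refine ⟨fun p => X.modP.left (X.ψ p q) p', fun p q' => ?_, fun f p w => ?_⟩
    · change _ = X.ψ p (X.modQ.right (X.ψ p' q') q)
      rw [X.ψ_left, X.ψ_right]
    · rw [fock_left f.2]; rfl
  | add a b ha hb =>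
    obtain ⟨Ω, h, h'⟩ := ha
    obtain ⟨Ω', k, k'⟩ := hb
    refine ⟨fun p => Ω p + Ω' p, fun p q => ?_, fun f p w => ?_⟩
    · rw [map_add, map_add, AddMonoidHom.add_apply, h, k, ← map_add]; rfl
    · rw [map_add, fock_add f.2, ← h', ← k']; rfl

/-- On words of positive length every compatible element acts as a finite rank operator. -/
lemma fockRep_σ_cons (hX : X.FS) {x : R} {t : TensorProduct ℤ Q P} (h : X.thetaHom t = X.Delta x)
    (f : X.fock) (p : P) (w : List P) :
    (X.fockRep.σ x f : List P → Unitization ℤ R) (p :: w) = (X.fockRep.TS t f).1 (p :: w) := by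
  obtain ⟨Ω, hΩ, hf⟩ := X.exists_fockRep_TS_cons t
  -- Both sides pair with q to ψ(p ⊗ xq), so nondegeneracy of ψ identifies them.
  have : Ω p = X.modP.right x p := by
    rw [← sub_eq_zero]
    refine X.eq_zero_of_ψ_right hX fun q => ?_
    rw [map_sub, AddMonoidHom.sub_apply, hΩ, h, X.ψ_balanced]
    exact sub_self _
  rw [hf, this]; rfl

/-! ### The image of T(J) in the Fock representation -/

/-- The vectors of finite length with values in `J`. -/
def fockIdeal (J : TwoSidedIdeal R) : AddSubgroup X.fock where
  carrier := {f | (∀ w, ∃ x ∈ J, f.1 w = (x : Unitization ℤ R)) ∧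
    ∃ n : ℕ, ∀ w, n ≤ w.length → f.1 w = 0}
  zero_mem' := ⟨fun _ => ⟨0, J.zero_mem, by simp⟩, 0, fun _ _ => rfl⟩
  add_mem' := by
    rintro f g ⟨hf, m, hm⟩ ⟨hg, n, hn⟩
    refine ⟨fun w => ?_, max m n, fun w hw => ?_⟩
    · obtain ⟨x, hx, h⟩ := hf w
      obtain ⟨y, hy, h'⟩ := hg w
      refine ⟨x + y, J.add_mem hx hy, ?_⟩
      rw [Unitization.inr_add, ← h, ← h']; rfl
    · change f.1 w + g.1 w = 0
      rw [hm w (by omega), hn w (by omega), add_zero]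
  neg_mem' := by
    rintro f ⟨hf, m, hm⟩
    refine ⟨fun w => ?_, m, fun w hw => ?_⟩
    · obtain ⟨x, hx, h⟩ := hf w
      refine ⟨-x, J.neg_mem hx, ?_⟩
      rw [Unitization.inr_neg, ← h]; rfl
    · change -f.1 w = 0
      rw [hm w hw, neg_zero]

variable {X} {J : TwoSidedIdeal R}

lemma wordAct_mem_ideal {f : List P → Unitization ℤ R}
    (hf : ∀ w, ∃ x ∈ J, f w = (x : Unitization ℤ R)) (r : R) (w : List P) :
    ∃ x ∈ J, X.wordAct r f w = (x : Unitization ℤ R) := by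
  cases w with
  | nil =>
    obtain ⟨x, hx, h⟩ := hf []
    exact ⟨r * x, J.mul_mem_left _ _ hx, by rw [wordAct, h, Unitization.inr_mul]⟩
  | cons p w => exact hf _

lemma wordAct_eq_zero {f : List P → Unitization ℤ R} {n : ℕ} (hf : ∀ w, n ≤ w.length → f w = 0)
    (r : R) (w : List P) (hw : n ≤ w.length) : X.wordAct r f w = 0 := by
  cases w with
  | nil => rw [wordAct, hf _ hw, mul_zero]
  | cons p w => exact hf _ hw

lemma fockRep_σ_mem_ideal {f : X.fock} (hf : f ∈ X.fockIdeal J) (r : R) :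
    X.fockRep.σ r f ∈ X.fockIdeal J := by
  obtain ⟨h, n, hn⟩ := hf
  exact ⟨wordAct_mem_ideal h r, n, wordAct_eq_zero hn r⟩

lemma fockRep_S_mem_ideal {f : X.fock} (hf : f ∈ X.fockIdeal J) (p : P) :
    X.fockRep.S p f ∈ X.fockIdeal J := by
  obtain ⟨h, n, hn⟩ := hf
  exact ⟨fun w => h _, n, fun w hw => hn _ (hw.trans (by simp))⟩

lemma fockRep_T_mem_ideal {f : X.fock} (hf : f ∈ X.fockIdeal J) (q : Q) :
    X.fockRep.T q f ∈ X.fockIdeal J := by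
  obtain ⟨h, n, hn⟩ := hf
  refine ⟨fun w => ?_, n + 1, fun w hw => ?_⟩
  · cases w with
    | nil => exact ⟨0, J.zero_mem, by simp [fockRep_T_nil]⟩
    | cons p w => exact wordAct_mem_ideal h _ w
  · cases w with
    | nil => rfl
    | cons p w => exact wordAct_eq_zero hn _ w (by simpa using hw)

/-- The elements of the Toeplitz ring that map the Fock module to the vectors of finite length
with values in `J`. -/
noncomputable def fockKer (J : TwoSidedIdeal R) {φ : X.Toeplitz →ₙ+* AddMonoid.End X.fock}
    (hφ : X.toeplitzRep.IsMorphism X.fockRep φ) : TwoSidedIdeal X.Toeplitz :=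
  TwoSidedIdeal.mk' {t | ∀ f, φ t f ∈ X.fockIdeal J}
    (fun f => by rw [map_zero]; exact zero_mem (X.fockIdeal J))
    (fun {x y} hx hy f => by rw [map_add]; exact add_mem (hx f) (hy f))
    (fun {x} hx f => by rw [map_neg]; exact neg_mem (hx f))
    (fun {x y} hy f => by
      -- Closure under left multiplication needs the whole Toeplitz ring to preserve `fockIdeal`;
      -- closure on the right is immediate, as the condition ranges over all vectors.
      have h : ∀ g ∈ X.fockIdeal J, φ x g ∈ X.fockIdeal J := by
        refine X.toeplitzRep_surjective.induction
          (p := fun x => ∀ g ∈ X.fockIdeal J, φ x g ∈ X.fockIdeal J) (fun r g hg => ?_)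
          (fun q g hg => ?_) (fun p g hg => ?_) (fun a b ha hb g hg => ?_) (fun a ha g hg => ?_)
          (fun a b ha hb g hg => ?_) x
        · rw [hφ.1]; exact fockRep_σ_mem_ideal hg r
        · rw [hφ.2.1]; exact fockRep_T_mem_ideal hg q
        · rw [hφ.2.2]; exact fockRep_S_mem_ideal hg p
        · rw [map_add]; exact add_mem (ha g hg) (hb g hg)
        · rw [map_neg]; exact neg_mem (ha g hg)
        · rw [map_mul]; exact ha _ (hb g hg)
      rw [map_mul]
      exact h _ (hy f))
    (fun {x y} hx f => by rw [map_mul]; exact hx _)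

lemma mem_fockKer {φ : X.Toeplitz →ₙ+* AddMonoid.End X.fock}
    (hφ : X.toeplitzRep.IsMorphism X.fockRep φ) {t : X.Toeplitz} :
    t ∈ X.fockKer J hφ ↔ ∀ f, φ t f ∈ X.fockIdeal J := by
  rw [fockKer, TwoSidedIdeal.mem_mk']; rfl

/-- With u = n + r the product is nx + xr, which stays in J although u comes from the unitization.
-/
lemma inr_mul_mem {x : R} (hx : x ∈ J) (u : Unitization ℤ R) :
    ∃ y ∈ J, (x : Unitization ℤ R) * u = (y : Unitization ℤ R) := by
  induction u using Unitization.ind with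
  | inl_add_inr n r =>
    refine ⟨n • x + x * r, J.add_mem (J.zsmul_mem n hx) (J.mul_mem_right _ _ hx), ?_⟩
    rw [mul_add, Unitization.inr_mul_inl, Unitization.inr_add, Unitization.inr_mul]

/-- A generator of T(J) acts as zero on nonempty words, and at the empty word it multiplies the
value by x, an element of J. -/
lemma toeplitzIdeal_le_fockKer (hX : X.FS) (hJ : X.Compatible J)
    {φ : X.Toeplitz →ₙ+* AddMonoid.End X.fock} (hφ : X.toeplitzRep.IsMorphism X.fockRep φ) :
    X.toeplitzIdeal hX J hJ ≤ X.fockKer J hφ := by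
  refine X.toeplitzIdeal_le hX J hJ _ fun x hx t ht => (mem_fockKer hφ).2 fun f => ?_
  rw [map_sub, hφ.1, hφ.map_TS]
  have hsub (w) : ((X.fockRep.σ x - X.fockRep.TS t) f : X.fock).1 w =
    (X.fockRep.σ x f).1 w - (X.fockRep.TS t f).1 w := rfl
  have hcons (p w) : ((X.fockRep.σ x - X.fockRep.TS t) f : X.fock).1 (p :: w) = 0 := by
    rw [hsub, X.fockRep_σ_cons hX ht, sub_self]
  refine ⟨fun w => ?_, 1, fun w hw => ?_⟩
  · cases w with
    | nil =>
      rw [hsub, X.fockRep_TS_nil, sub_zero]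
      exact inr_mul_mem hx _
    | cons p w => exact ⟨0, J.zero_mem, by rw [hcons, Unitization.inr_zero]⟩
  · cases w with
    | nil => simp at hw
    | cons p w => exact hcons p w

variable (X) in
/-- The vacuum vector. -/
def vacuum : X.fock :=
  ⟨fun w => match w with
    | [] => 1
    | _ :: _ => 0, by
    refine ⟨fun u p p' w => ?_, fun u r p w => ?_⟩
    · cases u <;> simp
    · cases u <;> cases w <;> simp [wordAct]⟩

lemma fockRep_σ_vacuum (r : R) : (X.fockRep.σ r X.vacuum).1 [] = (r : Unitization ℤ R) :=
  mul_one _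

lemma mem_of_σ_vacuum {x : R} (h : ∃ y ∈ J, (X.fockRep.σ x X.vacuum).1 [] = (y : Unitization ℤ R)) :
    x ∈ J := by
  obtain ⟨y, hy, h⟩ := h
  rw [fockRep_σ_vacuum] at h
  rwa [Unitization.inr_injective (R := ℤ) h]

/-! ### Faithfulness and the exact size of J -/

/-- An element that acts on the Fock module by vectors of finite length vanishes on all long
words. -/
lemma exists_wordAct_eq_zero {r : R} (h : ∀ f : X.fock, ∃ n : ℕ, ∀ w : List P, n ≤ w.length →
    (X.fockRep.σ r f).1 w = 0) :
    ∃ n : ℕ, ∀ (f : X.fock) (w : List P), n ≤ w.length → (X.fockRep.σ r f).1 w = 0 := by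
  classical
  have hF (n : ℕ) : ∃ f : X.fock, (∃ (g : X.fock) (w : List P), w.length = n ∧
      (X.fockRep.σ r g).1 w ≠ 0) → ∃ w : List P, w.length = n ∧ (X.fockRep.σ r f).1 w ≠ 0 := by
    by_cases hn : ∃ (g : X.fock) (w : List P), w.length = n ∧ (X.fockRep.σ r g).1 w ≠ 0
    · obtain ⟨g, hg⟩ := hn
      exact ⟨g, fun _ => hg⟩
    · exact ⟨0, fun h => absurd h hn⟩
  choose F hF using hF
  -- A diagonal vector: on words of length n it is the witness F n. The conditions defining `fock`
  -- relate only words of equal length, so vectors may be spliced length by length; σ(r) respects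
  -- this as well.
  let f : X.fock := ⟨fun w => (F w.length).1 w, by
    refine ⟨fun u p p' w => ?_, fun u s p w => ?_⟩
    · simp only [List.length_append, List.length_cons]
      exact (F _).2.1 u p p' w
    · simp only [List.length_append, List.length_cons]
      rw [(F _).2.2 u s p w]
      cases w <;> simp [wordAct]⟩
  have hf (w : List P) : (X.fockRep.σ r f).1 w = (X.fockRep.σ r (F w.length)).1 w := by
    cases w <;> rfl
  obtain ⟨n, hn⟩ := h f
  refine ⟨n, fun g w hw => ?_⟩
  by_contra hg
  obtain ⟨v, hv, hv'⟩ := hF w.length ⟨g, w, rfl, hg⟩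
  exact hv' (by rw [← hv, ← hf]; exact hn v (hv ▸ hw))

/-- The vacuum shows that r lies in J. Passing from r to ψ(p ⊗ rq) shortens the length bound by one,
so induction gives ψ(p ⊗ rq) = 0 for all p and q. Then Δ(r) = 0 by nondegeneracy, and faithfulness
finishes. -/
lemma eq_zero_of_fockRep_σ (hX : X.FS) (hJ : X.Faithful J) (n : ℕ) : ∀ r : R,
    (∀ (f : X.fock) (w : List P), ∃ x ∈ J, (X.fockRep.σ r f).1 w = (x : Unitization ℤ R)) →
    (∀ (f : X.fock) (w : List P), n ≤ w.length → (X.fockRep.σ r f).1 w = 0) → r = 0 := by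
  induction n with
  | zero =>
    intro r _ h
    have := h X.vacuum [] le_rfl
    rw [fockRep_σ_vacuum] at this
    exact Unitization.inr_injective (R := ℤ) this
  | succ n ih =>
    intro r h h'
    refine hJ r (mem_of_σ_vacuum (h X.vacuum [])) ?_
    ext q
    refine X.eq_zero_of_ψ_left hX fun p => ?_
    have key (f : X.fock) (w : List P) : (X.fockRep.σ (X.ψ p (X.modQ.left r q)) f).1 w =
        (X.fockRep.σ r (X.fockRep.T q f)).1 (p :: w) := by
      rw [X.fockRep.σ_ψ, X.fockRep.T_left]; rfl
    change X.ψ p (X.modQ.left r q) = 0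
    refine ih _ (fun f w => ?_) fun f w hw => ?_
    · rw [key]; exact h _ _
    · rw [key]; exact h' _ _ (by simpa using hw)

/-- For a faithful ideal `J` the ring `R` embeds into the relative Cuntz-Pimsner ring. -/
theorem cpRep_σ_eq_zero (hX : X.FS) (hJ : X.Compatible J) (hJ' : X.Faithful J) {r : R}
    (hr : (X.cpRep hX J hJ).σ r = 0) : r = 0 := by
  obtain ⟨φ, hφ⟩ := X.exists_toeplitz_hom X.fockRep
  have hr' : X.toeplitzRep.σ r ∈ X.toeplitzIdeal hX J hJ := by
    rw [← sub_zero (X.toeplitzRep.σ r), ← quotHom_eq_iff, map_zero]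
    exact hr
  have h := (mem_fockKer hφ).1 (toeplitzIdeal_le_fockKer hX hJ hφ hr')
  simp only [hφ.1] at h
  obtain ⟨n, hn⟩ := exists_wordAct_eq_zero fun f => (h f).2
  exact eq_zero_of_fockRep_σ hX hJ' n r (fun f => (h f).1) hn

/-- The ideal of the relative Cuntz-Pimsner representation is contained in `J`. -/
theorem cpRep_idealJ_le (hX : X.FS) (hJ : X.Compatible J) :
    (X.cpRep hX J hJ).idealJ hX ≤ J := by
  intro r hr
  obtain ⟨t, ht⟩ := ((X.cpRep hX J hJ).mem_idealJ_iff hX r).1 hr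
  obtain ⟨φ, hφ⟩ := X.exists_toeplitz_hom X.fockRep
  rw [← (X.toeplitz_isMorphism_cpRep hX J hJ).map_TS,
    ← (X.toeplitz_isMorphism_cpRep hX J hJ).1, quotHom_eq_iff] at ht
  have h := (mem_fockKer hφ).1 (toeplitzIdeal_le_fockKer hX hJ hφ ht) X.vacuum
  rw [map_sub, hφ.1, hφ.map_TS] at h
  -- At the empty word the finite rank part contributes nothing, so the vacuum value of the
  -- difference is r itself.
  refine mem_of_σ_vacuum (X := X) ?_
  obtain ⟨y, hy, h⟩ := h.1 []
  refine ⟨y, hy, h ▸ ?_⟩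
  change _ = (X.fockRep.σ r X.vacuum).1 [] - (X.fockRep.TS t X.vacuum).1 []
  rw [fockRep_TS_nil, sub_zero]

end RSystem

/-! ### Representations of quotient systems -/

section Quotient

variable {R P Q : Type*} [NonUnitalRing R] [AddCommGroup P] [AddCommGroup Q]
  {X : RSystem R P Q} {hX : X.FS} {I : TwoSidedIdeal R} {hI : X.Invariant I}
  {B : Type*} [NonUnitalRing B]

lemma RSystem.mem_idealQuot {I J : TwoSidedIdeal R} {x : I.ringCon.Quotient} :
    x ∈ RSystem.idealQuot I J ↔ ∃ y ∈ J, quotHom I.ringCon y = x :=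
  TwoSidedIdeal.mem_mk' _ _ _ _ _ _ _

lemma RSystem.quotHom_mem_idealQuot {I J : TwoSidedIdeal R} (hIJ : I ≤ J) {x : R} :
    quotHom I.ringCon x ∈ RSystem.idealQuot I J ↔ x ∈ J := by
  refine RSystem.mem_idealQuot.trans ⟨?_, fun hx => ⟨x, hx, rfl⟩⟩
  rintro ⟨y, hy, h⟩
  have := J.sub_mem hy (hIJ ((quotHom_eq_iff I y x).1 h))
  rwa [sub_sub_cancel] at this

lemma quotHom_eq_zero_iff (I : TwoSidedIdeal R) (x : R) : quotHom I.ringCon x = 0 ↔ x ∈ I := by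
  rw [← map_zero (quotHom I.ringCon), quotHom_eq_iff, sub_zero]

/-- The quotient map `Q ⊗ P → Q_I ⊗ _I P`. -/
def RSystem.quotTensor (X : RSystem R P Q) (I : TwoSidedIdeal R) :
    TensorProduct ℤ Q P →ₗ[ℤ] TensorProduct ℤ (X.QQuot I) (X.PQuot I) :=
  TensorProduct.map (QuotientAddGroup.mk' (X.QI I)).toIntLinearMap
    (QuotientAddGroup.mk' (X.IP I)).toIntLinearMap

lemma RSystem.quotTensor_surjective (X : RSystem R P Q) (I : TwoSidedIdeal R) :
    Function.Surjective (X.quotTensor I) :=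
  TensorProduct.map_surjective (QuotientAddGroup.mk'_surjective _)
    (QuotientAddGroup.mk'_surjective _)

lemma RSystem.thetaHom_quotTensor (t : TensorProduct ℤ Q P) (q : Q) :
    (X.quot hX I hI).thetaHom (X.quotTensor I t) (q : X.QQuot I) =
      (X.thetaHom t q : X.QQuot I) := by
  induction t using TensorProduct.induction_on with
  | zero => rw [map_zero, map_zero, map_zero]; rfl
  | tmul q p => rfl
  | add a b ha hb =>
    rw [map_add, map_add, map_add]
    exact congrArg₂ (· + ·) ha hb

namespace CovRep

/-- The representation of an `R`-system induced by one of a quotient system. -/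
def pullback (κ : CovRep (X.quot hX I hI) B) : CovRep X B where
  S := κ.S.comp (QuotientAddGroup.mk' (X.IP I))
  T := κ.T.comp (QuotientAddGroup.mk' (X.QI I))
  σ := κ.σ.comp (quotHom I.ringCon)
  S_right r p := κ.S_right (quotHom I.ringCon r) (p : X.PQuot I)
  S_left r p := κ.S_left (quotHom I.ringCon r) (p : X.PQuot I)
  T_right r q := κ.T_right (quotHom I.ringCon r) (q : X.QQuot I)
  T_left r q := κ.T_left (quotHom I.ringCon r) (q : X.QQuot I)
  σ_ψ p q := κ.σ_ψ (p : X.PQuot I) (q : X.QQuot I)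

lemma pullback_TS (κ : CovRep (X.quot hX I hI) B) (t : TensorProduct ℤ Q P) :
    κ.pullback.TS t = κ.TS (X.quotTensor I t) := by
  induction t using TensorProduct.induction_on with
  | zero => rw [map_zero, map_zero, map_zero]
  | tmul q p => rfl
  | add a b ha hb => rw [map_add, map_add, map_add, ha, hb]

/-- Tensors over the quotient bimodules lift to Q ⊗ P, so both representations have the same image
of π. -/
lemma mem_idealJ_pullback (κ : CovRep (X.quot hX I hI) B) (r : R) :
    r ∈ κ.pullback.idealJ hX ↔ quotHom I.ringCon r ∈ κ.idealJ (X.quot_FS hX I hI) := by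
  rw [mem_idealJ_iff, mem_idealJ_iff]
  constructor
  · rintro ⟨t, ht⟩
    exact ⟨X.quotTensor I t, ht.trans (κ.pullback_TS t)⟩
  · rintro ⟨t, ht⟩
    obtain ⟨t, rfl⟩ := X.quotTensor_surjective I t
    exact ⟨t, ht.trans (κ.pullback_TS t).symm⟩

lemma Surjective.pullback {κ : CovRep (X.quot hX I hI) B} (hκ : κ.Surjective) :
    κ.pullback.Surjective := by
  have hσ : Set.range κ.pullback.σ = Set.range κ.σ := (quotHom_surjective I.ringCon).range_comp κ.σ
  have hT : Set.range κ.pullback.T = Set.range κ.T :=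
    (QuotientAddGroup.mk'_surjective (X.QI I)).range_comp κ.T
  have hS : Set.range κ.pullback.S = Set.range κ.S :=
    (QuotientAddGroup.mk'_surjective (X.IP I)).range_comp κ.S
  rw [Surjective, hσ, hT, hS]
  exact hκ

/-- A representation whose `σ` vanishes on an invariant ideal `I` factors through the quotient
system. -/
lemma exists_pullback_eq (hX : X.FS) (hI : X.Invariant I) (ρ : CovRep X B) (h : I ≤ ρ.idealI) :
    ∃ κ : CovRep (X.quot hX I hI) B, κ.pullback = ρ := by
  have hσ : ∀ x ∈ I, ρ.σ x = 0 := fun x hx => (ρ.mem_idealI_iff x).1 (h hx)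
  refine ⟨{
    S := QuotientAddGroup.lift (X.IP I) ρ.S ((AddSubgroup.closure_le (AddMonoidHom.ker _)).2 ?_)
    T := QuotientAddGroup.lift (X.QI I) ρ.T ((AddSubgroup.closure_le (AddMonoidHom.ker _)).2 ?_)
    σ := conLift I.ringCon ρ.σ fun a b hab => by
      rw [← sub_eq_zero, ← map_sub]
      exact hσ _ ((I.rel_iff a b).1 hab)
    S_right := fun r p => Quotient.inductionOn₂' r p fun r p => ρ.S_right r p
    S_left := fun r p => Quotient.inductionOn₂' r p fun r p => ρ.S_left r p
    T_right := fun r p => Quotient.inductionOn₂' r p fun r p => ρ.T_right r p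
    T_left := fun r p => Quotient.inductionOn₂' r p fun r p => ρ.T_left r p
    σ_ψ := fun p q => Quotient.inductionOn₂' p q fun p q => ρ.σ_ψ p q }, rfl⟩
  · rintro _ ⟨p, x, hx, rfl⟩
    rw [SetLike.mem_coe, AddMonoidHom.mem_ker, ρ.S_left, hσ x hx, zero_mul]
  · rintro _ ⟨q, x, hx, rfl⟩
    rw [SetLike.mem_coe, AddMonoidHom.mem_ker, ρ.T_right, hσ x hx, mul_zero]

end CovRep

end Quotient

/-! ### The representation of a `T`-pair -/

section TPair

variable {R P Q : Type*} [NonUnitalRing R] [AddCommGroup P] [AddCommGroup Q]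
  {X : RSystem R P Q} {hX : X.FS} {ω : TwoSidedIdeal R × TwoSidedIdeal R}
  {B : Type*} [NonUnitalRing B]

/-- `tPairRep` is definitionally the `pullback` of the Cuntz-Pimsner representation relative to J/I.
-/
lemma tPairRep_surjective (hω : X.IsTPair hX ω) : (X.tPairRep hX hω).Surjective :=
  ((X.quot hX ω.1 hω.invariant).cpRep_surjective _ _ hω.compatible).pullback

lemma tPairRep_idealI (hω : X.IsTPair hX ω) : (X.tPairRep hX hω).idealI = ω.1 := by
  ext r
  rw [CovRep.mem_idealI_iff, ← quotHom_eq_zero_iff]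
  constructor
  · exact fun h => RSystem.cpRep_σ_eq_zero _ hω.compatible hω.faithful h
  · intro h
    exact (congrArg ((X.quot hX ω.1 hω.invariant).cpRep _ _ hω.compatible).σ h).trans (map_zero _)

lemma tPairRep_idealJ (hω : X.IsTPair hX ω) : (X.tPairRep hX hω).idealJ hX = ω.2 := by
  ext r
  refine (CovRep.mem_idealJ_pullback _ r).trans
    (Iff.trans ⟨fun h => RSystem.cpRep_idealJ_le _ hω.compatible h, fun h => ?_⟩
      (RSystem.quotHom_mem_idealQuot hω.le))
  obtain ⟨t, ht⟩ := (RSystem.mem_finRank_iff _ _).1 (hω.compatible _ h)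
  exact (CovRep.mem_idealJ_iff _ _ _).2 ⟨t, RSystem.cpRep_σ _ _ _ h ht⟩

/-- After factoring through the quotient system, the second inclusion puts σ(x) in the image of π
for x in J/I; `σ_eq_TS` then yields the precise relation needed. -/
lemma exists_tPair_hom (hω : X.IsTPair hX ω) {ρ : CovRep X B} (hI : ω.1 ≤ ρ.idealI)
    (hJ : ω.2 ≤ ρ.idealJ hX) :
    ∃ η : X.TPairRing hX hω →ₙ+* B, (X.tPairRep hX hω).IsMorphism ρ η := by
  obtain ⟨κ, rfl⟩ := CovRep.exists_pullback_eq hX hω.invariant ρ hI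
  obtain ⟨η, hη⟩ := (X.quot hX ω.1 hω.invariant).exists_cp_hom (X.quot_FS hX ω.1 hω.invariant)
    (RSystem.idealQuot ω.1 ω.2) hω.compatible κ fun x hx t ht => by
      refine κ.σ_eq_TS (X.quot_FS hX ω.1 hω.invariant) ?_ fun q => by rw [ht]; rfl
      obtain ⟨y, hy, rfl⟩ := RSystem.mem_idealQuot.1 hx
      exact (κ.mem_idealJ_pullback y).1 (hJ hy)
  exact ⟨η, fun r => hη.1 (quotHom ω.1.ringCon r), fun q => hη.2.1 (q : X.QQuot ω.1),
    fun p => hη.2.2 (p : X.PQuot ω.1)⟩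

/-! ### Comparison of T-pairs along morphisms -/

lemma CovRep.IsMorphism.idealI_le {C : Type*} [NonUnitalRing C] {ρ : CovRep X B} {ρ' : CovRep X C}
    {η : B →ₙ+* C} (h : ρ.IsMorphism ρ' η) : ρ.idealI ≤ ρ'.idealI := fun r hr => by
  rw [CovRep.mem_idealI_iff] at hr ⊢
  rw [← h.1, hr, map_zero]

lemma CovRep.IsMorphism.idealJ_le {C : Type*} [NonUnitalRing C] {ρ : CovRep X B} {ρ' : CovRep X C}
    {η : B →ₙ+* C} (h : ρ.IsMorphism ρ' η) (hX : X.FS) :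
    ρ.idealJ hX ≤ ρ'.idealJ hX := fun r hr => by
  rw [CovRep.mem_idealJ_iff] at hr ⊢
  obtain ⟨t, ht⟩ := hr
  exact ⟨t, by rw [← h.1, ht, h.map_TS]⟩

lemma CovRep.IsMorphism.le_idealI {C : Type*} [NonUnitalRing C] {ρ : CovRep X B} {ρ' : CovRep X C}
    {η : B →ₙ+* C} (h : ρ.IsMorphism ρ' η) (hη : Function.Injective η) :
    ρ'.idealI ≤ ρ.idealI := fun r hr => by
  rw [CovRep.mem_idealI_iff] at hr ⊢
  exact hη (by rw [h.1, hr, map_zero])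

lemma CovRep.IsMorphism.le_idealJ {C : Type*} [NonUnitalRing C] {ρ : CovRep X B} {ρ' : CovRep X C}
    {η : B →ₙ+* C} (h : ρ.IsMorphism ρ' η) (hX : X.FS) (hη : Function.Injective η) :
    ρ'.idealJ hX ≤ ρ.idealJ hX := fun r hr => by
  rw [CovRep.mem_idealJ_iff] at hr ⊢
  obtain ⟨t, ht⟩ := hr
  exact ⟨t, hη (by rw [h.1, ht, h.map_TS])⟩

/-- An isomorphism of representations has an inverse. -/
lemma CovRep.IsMorphism.symm {C : Type*} [NonUnitalRing C] {ρ : CovRep X B} {ρ' : CovRep X C}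
    {e : B ≃+* C} (h : ρ.IsMorphism ρ' (e : B →ₙ+* C)) :
    ρ'.IsMorphism ρ (e.symm : C →ₙ+* B) :=
  ⟨fun r => e.symm_apply_eq.2 (h.1 r).symm, fun q => e.symm_apply_eq.2 (h.2.1 q).symm,
    fun p => e.symm_apply_eq.2 (h.2.2 p).symm⟩

/-- The inclusions persist for `laurent`, since σ and T(q)S(p) both sit in degree zero. The
universal property then gives a coaction, carried to B by the inverse of e. -/
lemma tPair_graded (hω : X.IsTPair hX ω) {ρ : CovRep X B} (hI : ω.1 ≤ ρ.idealI)
    (hJ : ω.2 ≤ ρ.idealJ hX) {e : X.TPairRing hX hω ≃+* B}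
    (he : (X.tPairRep hX hω).IsMorphism ρ (e : X.TPairRing hX hω →ₙ+* B)) (hρ : ρ.Surjective) :
    ρ.Graded := by
  obtain ⟨δ, hδ⟩ := exists_tPair_hom hω (ρ := ρ.laurent)
    (fun r hr => by
      rw [CovRep.mem_idealI_iff]
      change AddMonoidAlgebra.single _ ((ρ.σ r : B) : Unitization ℤ B) = 0
      rw [(ρ.mem_idealI_iff r).1 (hI hr), Unitization.inr_zero, AddMonoidAlgebra.single_zero])
    (fun r hr => by
      obtain ⟨t, ht⟩ := (ρ.mem_idealJ_iff hX r).1 (hJ hr)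
      refine (CovRep.mem_idealJ_iff _ _ _).2 ⟨t, ?_⟩
      rw [CovRep.laurent_TS, ← ht]; rfl)
  have he' := he.symm
  refine CovRep.graded_of_coaction hρ (δ := δ.comp (e.symm : B →ₙ+* X.TPairRing hX hω))
    ⟨fun r => ?_, fun q => ?_, fun p => ?_⟩
  · rw [NonUnitalRingHom.comp_apply, he'.1, hδ.1]
  · rw [NonUnitalRingHom.comp_apply, he'.2.1, hδ.2.1]
  · rw [NonUnitalRingHom.comp_apply, he'.2.2, hδ.2.2]

lemma isTPair_pair (hX : X.FS) (ρ : CovRep X B) : X.IsTPair hX (ρ.pair hX) := by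
  have hle : ρ.idealI ≤ ρ.idealJ hX := fun r hr =>
    (ρ.mem_idealJ_iff hX r).2 ⟨0, by rw [(ρ.mem_idealI_iff r).1 hr, map_zero]⟩
  have hinv : X.Invariant ρ.idealI := fun p q x hx => by
    rw [ρ.mem_idealI_iff] at hx ⊢
    rw [ρ.σ_ψ, ρ.T_left, hx, zero_mul, mul_zero]
  refine ⟨hle, hinv, fun x hx => ?_, fun x hx h => ?_⟩
  · obtain ⟨y, hy, rfl⟩ := RSystem.mem_idealQuot.1 hx
    obtain ⟨t, ht⟩ := (ρ.mem_idealJ_iff hX y).1 hy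
    refine (RSystem.mem_finRank_iff _ _).2 ⟨X.quotTensor ρ.idealI t, ?_⟩
    ext q
    obtain ⟨q, rfl⟩ := QuotientAddGroup.mk_surjective q
    refine (RSystem.thetaHom_quotTensor t q).trans (Eq.symm ?_)
    refine QuotientAddGroup.eq_iff_sub_mem.2 ?_
    -- The vector yq − Θ_t(q), with Θ_t the operator of t, is killed by T, so its pairings with P
    -- lie in ker σ. A finite rank operator fixing it then puts it in QI.
    obtain ⟨Θ, hΘ, hfix⟩ := (hX {X.modQ.left y q - X.thetaHom t q} ∅).1
    refine hfix _ (Finset.mem_singleton_self _) ▸ X.finRank_mem_QI ρ.idealI hΘ _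
      fun p => (ρ.mem_idealI_iff _).2 ?_
    rw [ρ.σ_ψ, map_sub, ρ.T_left, ht, ρ.T_thetaHom, sub_self, mul_zero]
  · obtain ⟨y, hy, rfl⟩ := RSystem.mem_idealQuot.1 hx
    obtain ⟨t, ht⟩ := (ρ.mem_idealJ_iff hX y).1 hy
    refine (quotHom_eq_zero_iff _ _).2 ((ρ.mem_idealI_iff y).2 ?_)
    rw [ht]
    -- A trivial action of y on Q/QI puts yq in QI, which T kills. So σ(y) annihilates T(Q) while
    -- lying in B S(P).
    refine ρ.eq_zero_of_mul_T hX (ρ.TS_mem_right t) fun q => ?_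
    rw [← ht, ← ρ.T_left]
    have hq : X.modQ.left y q ∈ X.QI ρ.idealI :=
      (QuotientAddGroup.eq_zero_iff _).1 (DFunLike.congr_fun h (q : X.QQuot ρ.idealI))
    have hle : X.QI ρ.idealI ≤ ρ.T.ker := (AddSubgroup.closure_le _).2 (by
      rintro _ ⟨q, x, hx, rfl⟩
      rw [SetLike.mem_coe, AddMonoidHom.mem_ker, ρ.T_right, (ρ.mem_idealI_iff x).1 hx, mul_zero])
    exact hle hq

lemma tPair_bijective (hω : X.IsTPair hX ω) {ρ : CovRep X B} {η : X.TPairRing hX hω →ₙ+* B}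
    (hη : (X.tPairRep hX hω).IsMorphism ρ η) (hρ : ρ.Surjective) (hg : ρ.Graded)
    (h : ω = ρ.pair hX) : Function.Bijective η := by
  refine ⟨hη.injective_of_graded hX (tPairRep_surjective hω) hg (fun r hr => ?_) ?_,
    hρ.surjective hη⟩
  · rw [← CovRep.mem_idealI_iff, tPairRep_idealI, h]
    exact (ρ.mem_idealI_iff r).2 hr
  · rw [tPairRep_idealJ, h]; exact le_rfl

lemma eq_pair_of_injective (hω : X.IsTPair hX ω) {ρ : CovRep X B} {η : X.TPairRing hX hω →ₙ+* B}
    (hη : (X.tPairRep hX hω).IsMorphism ρ η) (h : Function.Injective η) : ω = ρ.pair hX := by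
  refine Prod.ext (le_antisymm ?_ ?_) (le_antisymm ?_ ?_)
  · exact (tPairRep_idealI hω).ge.trans hη.idealI_le
  · exact (hη.le_idealI h).trans (tPairRep_idealI hω).le
  · exact (tPairRep_idealJ hω).ge.trans (hη.idealJ_le hX)
  · exact (hη.le_idealJ hX h).trans (tPairRep_idealJ hω).le

end TPair

end CuntzPimsner

theorem theorem7 {R P Q : Type*} [NonUnitalRing R] [AddCommGroup P] [AddCommGroup Q]
    (X : CuntzPimsner.RSystem R P Q) (hX : X.FS)
    {B : Type*} [NonUnitalRing B] (ρ : CuntzPimsner.CovRep X B) :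
    (∀ (ω : TwoSidedIdeal R × TwoSidedIdeal R) (hω : X.IsTPair hX ω),
      ((∃ η : X.TPairRing hX hω →ₙ+* B, (X.tPairRep hX hω).IsMorphism ρ η) →
        ω.1 ≤ ρ.idealI ∧ ω.2 ≤ ρ.idealJ hX) ∧
      (ω.1 ≤ ρ.idealI → ω.2 ≤ ρ.idealJ hX →
        ∃! η : X.TPairRing hX hω →ₙ+* B, (X.tPairRep hX hω).IsMorphism ρ η) ∧
      (ω.1 ≤ ρ.idealI → ω.2 ≤ ρ.idealJ hX →
        ∀ η : X.TPairRing hX hω →ₙ+* B, (X.tPairRep hX hω).IsMorphism ρ η →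
          (Function.Bijective η ↔ ρ.Surjective ∧ ρ.Graded ∧ ω = ρ.pair hX))) ∧
    (ρ.Surjective → ρ.Graded →
      ∃ (ω : TwoSidedIdeal R × TwoSidedIdeal R) (hω : X.IsTPair hX ω)
        (e : X.TPairRing hX hω ≃+* B),
        (X.tPairRep hX hω).IsMorphism ρ (e : X.TPairRing hX hω →ₙ+* B)) := by
  refine ⟨fun ω hω => ⟨?_, fun hI hJ => ?_, fun hI hJ η hη => ⟨fun hb => ?_, ?_⟩⟩, fun hs hg => ?_⟩
  · rintro ⟨η, hη⟩
    exact ⟨(CuntzPimsner.tPairRep_idealI hω).ge.trans hη.idealI_le,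
      (CuntzPimsner.tPairRep_idealJ hω).ge.trans (hη.idealJ_le hX)⟩
  · obtain ⟨η, hη⟩ := CuntzPimsner.exists_tPair_hom hω hI hJ
    exact ⟨η, hη, fun η' hη' => (CuntzPimsner.tPairRep_surjective hω).hom_ext hη' hη⟩
  · have hs := (CuntzPimsner.tPairRep_surjective hω).map hη hb.2
    -- Surjectivity of η already makes ρ surjective; the grading uses the inverse of η, and the
    -- equality of pairs its injectivity.
    exact ⟨hs, CuntzPimsner.tPair_graded hω hI hJ (e := RingEquiv.ofBijective η hb) hη hs,
      CuntzPimsner.eq_pair_of_injective hω hη hb.1⟩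
  · rintro ⟨hs, hg, h⟩
    exact CuntzPimsner.tPair_bijective hω hη hs hg h
  · have hω := CuntzPimsner.isTPair_pair hX ρ
    obtain ⟨η, hη⟩ := CuntzPimsner.exists_tPair_hom (ρ := ρ) hω le_rfl le_rfl
    exact ⟨_, hω, RingEquiv.ofBijective η (CuntzPimsner.tPair_bijective hω hη hs hg rfl), hη⟩
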